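/- Let $\mathbb D$ be an infinite set of data values. A data word over a finite alphabet $\mathbb A$ is a nonempty finite word over $\mathbb A\times\mathbb D$; a position $i$ of it has type $\rhd$ if $i+1$ is a position and type $\bar\rhd$ otherwise. An automaton $\mathcal A=\langle\mathbb A,Q,q_I,\delta\rangle$ of the class $\mathsf{ARA}(\mathsf{guess},\mathsf{spread})$ consists of a finite alphabet $\mathbb A$, a finite set $Q$ of states, an initial state $q_I\in Q$, and a map $\delta$ from $Q$ to instructions of the forms $$a\mid\bar a\mid\rhd?\mid\bar\rhd?\mid\mathsf{store}(q)\mid\mathsf{eq}\mid\overline{\mathsf{eq}}\mid q\wedge q'\mid q\vee q'\mid\rhd q\mid\mathsf{guess}(q)\mid\mathsf{spread}(q,q')\qquad(a\in\mathbb A,\ q,q'\in Q).$$ A configuration is a tuple $\langle i,\alpha,(a,d),\Delta\rangle$ of a position $i$, a type $\alpha\in\{\rhd,\bar\rhd\}$, a letter $a\in\mathbb A$, a datum $d\in\mathbb D$, and a finite set $\Delta\subseteq Q\times\mathbb D$ of threads (state, register value). The relation $\rightarrowtail$ on configurations has the following transitions. (1) From $\langle i,\alpha,(a,d),\{(q,d')\}\cup\Delta\rangle$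 to $\langle i,\alpha,(a,d),\Delta'\rangle$, where $\Delta'$ is - $\{(q_j,d')\}\cup\Delta$ with $j\in\{1,2\}$, if $\delta(q)=q_1\vee q_2$; - $\{(q_1,d'),(q_2,d')\}\cup\Delta$, if $\delta(q)=q_1\wedge q_2$; - $\{(q',d)\}\cup\Delta$, if $\delta(q)=\mathsf{store}(q')$; - $\{(q',e)\}\cup\Delta$ for any $e\in\mathbb D$, if $\delta(q)=\mathsf{guess}(q')$; - $\Delta$, if $\delta(q)$ is a test that succeeds, that is, $\mathsf{eq}$ with $d=d'$, or $\overline{\mathsf{eq}}$ with $d\ne d'$, or $\beta?$ with $\beta=\alpha$, or $b$ with $b=a$, or $\bar b$ with $b\ne a$; - $\{(q_1,e)\mid(q_2,e)\in\Delta\}\cup\Delta$, if $\delta(q)=\mathsf{spread}(q_2,q_1)$ and for every $(\tilde q,\tilde d)\in\Delta$ the instruction $\delta(\tilde q)$ is a $\mathsf{spread}$ or of the form $\rhd q'$. (2) From $\langle i,\rhd,\gamma,\Delta\rangle$ to $\langle i+1,\alpha',\gamma',\{(q',e)\mid(q,e)\in\Delta,\ \delta(q)=\rhd q'\}\rangle$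 for any $\alpha'\in\{\rhd,\bar\rhd\}$ and $\gamma'\in\mathbb A\times\mathbb D$, if $\delta(q)$ has the form $\rhd q'$ for every $(q,e)\in\Delta$. A run of $\mathcal A$ over a data word $w$ is a nonempty finite sequence $\mathcal C_1\rightarrowtail\dots\rightarrowtail\mathcal C_n$ of configurations, each of the form $\langle i,\alpha,w(i),\Delta\rangle$ with $i$ a position of $w$ and $\alpha$ its type, such that $\mathcal C_1$ is at the first position and its only thread is $(q_I,d_1)$, where $d_1$ is the first datum of $w$. The run is accepting if the set of threads of $\mathcal C_n$ is empty; a configuration with no threads is called accepting. $L(\mathcal A)$ is the set of data words that have an accepting run. For configurations, $\rho\sim\rho'$ means that some bijection between the data values occurring in $\rho$ and those occurring in $\rho'$ transforms $\rho$ into $\rho'$; $\langle i,\alpha,\gamma,\Delta\rangle\preceq\langle i',\alpha',\gamma',\Delta'\rangle$ means $\alpha=\alpha'$, $\gamma=\gamma'$ and $\Delta\subseteq\Delta'$; and $\rho\precsim\rho'$ means that $\rho\preceq\rho''$ for some $\rho''\sim\rho'$. **Theorem.** The emptiness problem for $\mathsf{ARA}(\mathsf{guess},\mathsf{spread})$,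 that is, given (a finite description of) an automaton $\mathcal A$ of this class, to decide whether $L(\mathcal A)=\emptyset$, is decidable. Moreover, for every such $\mathcal A$: - $\precsim$ is a well-quasi-order on the set of configurations; - $\rightarrowtail$ is reflexive downward compatible with $\precsim$: if $\rho'\precsim\rho$ and $\rho\rightarrowtail\tau$, then there is $\tau'\precsim\tau$ with $\rho'\rightarrowtail\tau'$ or $\tau'=\rho'$; - the set of accepting configurations is downward closed with respect to $\precsim$. -/

import Mathlib

universe u v w

/-- The type of a position of a word: `hasNext` (written `▷`) if there is a next position,
`isLast` (written `▷` with a bar) if there is none. -/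
inductive WordType where
  | hasNext
  | isLast

/-- The instructions `Φ` of an alternating one-register automaton with `guess` and `spread`,
over the alphabet `A` and the states `Q`. -/
inductive Instr (A : Type v) (Q : Type w) where
  | letter (a : A)
  | notLetter (a : A)
  | test (β : WordType)
  | store (q : Q)
  | eq
  | neq
  | and (q₁ q₂ : Q)
  | or (q₁ q₂ : Q)
  | move (q : Q)
  | guess (q : Q)
  | spread (q₂ q₁ : Q)

/-- An automaton of `ARA(guess, spread)` with alphabet `A` and set of states `Q`
(both are taken finite wherever automata are quantified over). -/
structure ARA (A : Type v) (Q : Type w) where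
  start : Q
  δ : Q → Instr A Q

namespace Instr

variable {A : Type v} {Q : Type w}

def IsMoving (φ : Instr A Q) : Prop := ∃ q, φ = move q

def IsSpread (φ : Instr A Q) : Prop := ∃ q₂ q₁, φ = spread q₂ q₁

/-- An instruction written as a tag with two arguments, given numberings of `A` and `Q`. -/
def code {k n : ℕ} (eA : A ≃ Fin k) (eQ : Q ≃ Fin n) : Instr A Q → ℕ × ℕ × ℕ
  | letter a => (0, eA a, 0)
  | notLetter a => (1, eA a, 0)
  | test .hasNext => (2, 0, 0)
  | test .isLast => (2, 1, 0)
  | store q => (3, eQ q, 0)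
  | eq => (4, 0, 0)
  | neq => (5, 0, 0)
  | and q₁ q₂ => (6, eQ q₁, eQ q₂)
  | or q₁ q₂ => (7, eQ q₁, eQ q₂)
  | move q => (8, eQ q, 0)
  | guess q => (9, eQ q, 0)
  | spread q₂ q₁ => (10, eQ q₂, eQ q₁)

theorem code_injective {k n : ℕ} (eA : A ≃ Fin k) (eQ : Q ≃ Fin n) :
    Function.Injective (code eA eQ) := by
  intro φ ψ h
  rcases φ with _ | _ | ⟨_ | _⟩ | _ | _ | _ | _ | _ | _ | _ | _ <;>
    rcases ψ with _ | _ | ⟨_ | _⟩ | _ | _ | _ | _ | _ | _ | _ | _ <;>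
    simp_all [code, Fin.val_inj]

end Instr

/-- A configuration `⟨i, α, γ, Δ⟩`: position, word type, letter and datum of the position, and
finite set of threads (state, register value). Positions are numbered from `0`. -/
@[ext]
structure Config (A : Type v) (Q : Type w) (D : Type u) where
  pos : ℕ
  type : WordType
  label : A × D
  threads : Finset (Q × D)

namespace Config

variable {A : Type v} {Q : Type w} {D : Type u}

/-- The configuration describes a position of the data word `x`, with its type and label. -/
def Fits (x : List (A × D)) (C : Config A Q D) : Prop :=
  x[C.pos]? = some C.label ∧ (C.type = .hasNext ↔ C.pos + 1 < x.length)

def Accepting (C : Config A Q D) : Prop := C.threads = ∅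

/-- The data values that occur in a configuration. -/
def data (C : Config A Q D) : Set D :=
  {e | e = C.label.2 ∨ ∃ q, (q, e) ∈ C.threads}

/-- The replacement of every data value `e` by `f e`. -/
def rename [DecidableEq Q] [DecidableEq D] (f : D → D) (C : Config A Q D) : Config A Q D :=
  ⟨C.pos, C.type, (C.label.1, f C.label.2), C.threads.image fun t => (t.1, f t.2)⟩

/-- `ρ ∼ ρ'`: some bijection `data ρ → data ρ'` turns `ρ` into `ρ'`. -/
def Equiv [DecidableEq Q] [DecidableEq D] (ρ ρ' : Config A Q D) : Prop :=
  ∃ f : D → D, Set.BijOn f ρ.data ρ'.data ∧ ρ.rename f = ρ'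

/-- `ρ ⪯ ρ'`: inclusion of threads; the position is ignored. -/
def Incl (ρ ρ' : Config A Q D) : Prop :=
  ρ.type = ρ'.type ∧ ρ.label = ρ'.label ∧ ρ.threads ⊆ ρ'.threads

/-- `ρ ≾ ρ'`: inclusion of threads modulo renaming of data values. -/
def Below [DecidableEq Q] [DecidableEq D] (ρ ρ' : Config A Q D) : Prop :=
  ∃ ρ'', ρ''.Equiv ρ' ∧ ρ.Incl ρ''

end Config

namespace ARA

variable {A : Type v} {Q : Type w} {D : Type u} [DecidableEq Q] [DecidableEq D]

/-- The non-moving transitions. As `Δ` is arbitrary, `insert t Δ` is any set of threads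
that contains `t`. -/
inductive StepEps (M : ARA A Q) : Config A Q D → Config A Q D → Prop
  | or_left {i α γ q e Δ q₁ q₂} (h : M.δ q = .or q₁ q₂) :
      StepEps M ⟨i, α, γ, insert (q, e) Δ⟩ ⟨i, α, γ, insert (q₁, e) Δ⟩
  | or_right {i α γ q e Δ q₁ q₂} (h : M.δ q = .or q₁ q₂) :
      StepEps M ⟨i, α, γ, insert (q, e) Δ⟩ ⟨i, α, γ, insert (q₂, e) Δ⟩
  | and {i α γ q e Δ q₁ q₂} (h : M.δ q = .and q₁ q₂) :
      StepEps M ⟨i, α, γ, insert (q, e) Δ⟩ ⟨i, α, γ, {(q₁, e), (q₂, e)} ∪ Δ⟩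
  | store {i α a d q e Δ q'} (h : M.δ q = .store q') :
      StepEps M ⟨i, α, (a, d), insert (q, e) Δ⟩ ⟨i, α, (a, d), insert (q', d) Δ⟩
  | eq {i α a d q e Δ} (h : M.δ q = .eq) (hd : d = e) :
      StepEps M ⟨i, α, (a, d), insert (q, e) Δ⟩ ⟨i, α, (a, d), Δ⟩
  | neq {i α a d q e Δ} (h : M.δ q = .neq) (hd : d ≠ e) :
      StepEps M ⟨i, α, (a, d), insert (q, e) Δ⟩ ⟨i, α, (a, d), Δ⟩
  | test {i α γ q e Δ β} (h : M.δ q = .test β) (hβ : β = α) :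
      StepEps M ⟨i, α, γ, insert (q, e) Δ⟩ ⟨i, α, γ, Δ⟩
  | letter {i α a d q e Δ b} (h : M.δ q = .letter b) (hb : b = a) :
      StepEps M ⟨i, α, (a, d), insert (q, e) Δ⟩ ⟨i, α, (a, d), Δ⟩
  | notLetter {i α a d q e Δ b} (h : M.δ q = .notLetter b) (hb : b ≠ a) :
      StepEps M ⟨i, α, (a, d), insert (q, e) Δ⟩ ⟨i, α, (a, d), Δ⟩
  | guess {i α γ q e Δ q'} (h : M.δ q = .guess q') (e' : D) :
      StepEps M ⟨i, α, γ, insert (q, e) Δ⟩ ⟨i, α, γ, insert (q', e') Δ⟩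
  | spread {i α γ q e Δ q₂ q₁} (h : M.δ q = .spread q₂ q₁)
      (hΔ : ∀ t ∈ Δ, (M.δ t.1).IsSpread ∨ (M.δ t.1).IsMoving) :
      StepEps M ⟨i, α, γ, insert (q, e) Δ⟩
        ⟨i, α, γ, (Δ.filter fun t => t.1 = q₂).image (fun t => (q₁, t.2)) ∪ Δ⟩

/-- The moving transitions: all threads advance simultaneously to a next position with an
arbitrary type and label. -/
inductive StepMove (M : ARA A Q) : Config A Q D → Config A Q D → Prop
  | mk {i γ Δ α' γ' Δ'} (hmov : ∀ t ∈ Δ, (M.δ t.1).IsMoving)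
      (hΔ : ∀ t : Q × D, t ∈ Δ' ↔ ∃ q, (q, t.2) ∈ Δ ∧ M.δ q = .move t.1) :
      StepMove M ⟨i, .hasNext, γ, Δ⟩ ⟨i + 1, α', γ', Δ'⟩

/-- The transition relation between configurations. -/
def Step (M : ARA A Q) (C C' : Config A Q D) : Prop :=
  M.StepMove C C' ∨ M.StepEps C C'

/-- The nonempty sequence `r` of configurations is a run of `M` over the data word `x`. -/
def IsRun (M : ARA A Q) (x : List (A × D)) (r : List (Config A Q D)) : Prop :=
  (∃ α γ, r.head? = some ⟨0, α, γ, {(M.start, γ.2)}⟩) ∧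
    r.IsChain M.Step ∧ ∀ C ∈ r, C.Fits x

/-- The set of data words with an accepting run. Data words are nonempty; the list `[]` has
no run because no configuration fits it. -/
def language (M : ARA A Q) (D : Type u) [DecidableEq D] : Set (List (A × D)) :=
  {x | ∃ r, M.IsRun x r ∧ ∃ C, r.getLast? = some C ∧ C.Accepting}

end ARA

namespace ARA

variable {A : Type v} {Q : Type w}

/-- The finite description of an automaton that is the input of the emptiness problem, given
numberings of the alphabet and the states: the size of the alphabet, the number of the initial
state, and the table of `δ`. -/
def code (M : ARA A Q) {k n : ℕ} (eA : A ≃ Fin k) (eQ : Q ≃ Fin n) :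
    ℕ × ℕ × List (ℕ × ℕ × ℕ) :=
  (k, eQ M.start, List.ofFn fun j : Fin n => (M.δ (eQ.symm j)).code eA eQ)

theorem code_injective {k n : ℕ} (eA : A ≃ Fin k) (eQ : Q ≃ Fin n) :
    Function.Injective fun M : ARA A Q => M.code eA eQ := by
  rintro ⟨s, δ⟩ ⟨s', δ'⟩ h
  simp only [code, Prod.mk.injEq, true_and, Fin.val_inj, EmbeddingLike.apply_eq_iff_eq] at h
  obtain ⟨rfl, h⟩ := h
  have h2 := List.ofFn_injective h
  congr 1
  funext q
  simpa using Instr.code_injective eA eQ (congrFun h2 (eQ q))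

end ARA

/-- `r` is a well-quasi-order. -/
def IsWQO {S : Type*} (r : S → S → Prop) : Prop :=
  (∀ a, r a a) ∧ (∀ a b c, r a b → r b c → r a c) ∧ WellQuasiOrdered r

/-- The transition system `step` is reflexive downward compatible with respect to `r`. -/
def IsRDC {S : Type*} (step r : S → S → Prop) : Prop :=
  ∀ a₁ a₂ a₁', r a₁' a₁ → step a₁ a₂ → ∃ a₂', r a₂' a₂ ∧ (step a₁' a₂' ∨ a₁' = a₂')

/-- The set `V` is downward closed with respect to `r`. -/
def IsDownwardClosed {S : Type*} (r : S → S → Prop) (V : Set S) : Prop :=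
  ∀ a b, b ∈ V → r a b → a ∈ V

/-! Up to renaming and apart from its position, a configuration is determined by its type, its
letter, the set of states on the current datum and, for every set `S` of states, the number of other
values whose threads have exactly the states `S`. The first three range over finite sets and the
last is a vector in `Finset Q → ℕ`. Equality of the former and the componentwise order on the latter
imply `Config.Below` (`Config.below_of_card_valuesWith_le`), so Dickson's lemma gives the
well-quasi-order.

Transitions commute with permutations of `D`, so compatibility only has to be checked for inclusion
of threads (`ARA.Step.exists_of_incl`). If the thread that fires is missing from the smaller
configuration, that configuration stays put. Otherwise it performs the same transition: having fewer
threads only weakens the conditions on `spread` and on moves, and only shrinks the result.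

Since a move chooses the next type and label freely, nonemptiness is reachability of a configuration
without threads (`ARA.language_eq_empty_iff`). A single search over `m` looks for evidence of either
outcome. Evidence of nonemptiness is an accepting member of the finite list `CodedConfig.reached a
m`. Evidence of emptiness is a finite set of coded configurations over finitely many values, none
accepting, that covers the initial ones and is closed under successors up to inclusion
(`CodedConfig.EmptinessCert`).

Such a certificate is sound because a transition introduces at most one new value, and an unused
number can stand for it (`CodedConfig.CodesPart.exists_successor`). It exists when the language is
empty because the well-quasi-order bounds the size of minimal reachable configurations: for some
`K`, every reachable configuration includes a reachable one with at most `K` threads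
(`ARA.exists_card_threads_le`). The codes of the latter over `K + 2` values form the required finite
set. -/

/-- This lets the bijections between data sets in the definition of `∼` be replaced by permutations
of all of `D`, which can be composed and inverted freely. -/
theorem Set.InjOn.exists_perm_eqOn {D : Type u} {s : Set D} (hs : s.Finite) {f : D → D}
    (hf : s.InjOn f) : ∃ π : Equiv.Perm D, s.EqOn π f := by
  have := hs.to_subtype
  obtain ⟨π, hπ⟩ := Equiv.Perm.exists_extending_pair (Subtype.val : s → D) (fun x => f x)
    Subtype.val_injective (Set.injOn_iff_injective.1 hf)
  exact ⟨π, fun d hd => hπ ⟨d, hd⟩⟩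

/-! ### Renaming of data values and the well-quasi-order. -/

namespace Config

variable {A : Type v} {Q : Type w} {D : Type u}

theorem label_mem_data (C : Config A Q D) : C.label.2 ∈ C.data := Or.inl rfl

theorem mem_data_of_mem_threads {C : Config A Q D} {t : Q × D} (ht : t ∈ C.threads) :
    t.2 ∈ C.data := Or.inr ⟨t.1, ht⟩

theorem data_eq [DecidableEq D] (C : Config A Q D) :
    C.data = ↑(insert C.label.2 (C.threads.image Prod.snd)) := by
  ext e
  simp [data]

theorem finite_data [DecidableEq D] (C : Config A Q D) : C.data.Finite := by
  rw [data_eq]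
  exact Finset.finite_toSet _

theorem Incl.refl (C : Config A Q D) : C.Incl C := ⟨rfl, rfl, Finset.Subset.refl _⟩

theorem Incl.trans {C₁ C₂ C₃ : Config A Q D} (h : C₁.Incl C₂) (h' : C₂.Incl C₃) : C₁.Incl C₃ :=
  ⟨h.1.trans h'.1, h.2.1.trans h'.2.1, h.2.2.trans h'.2.2⟩

variable [DecidableEq Q] [DecidableEq D]

theorem rename_congr {f g : D → D} {C : Config A Q D} (h : C.data.EqOn f g) :
    C.rename f = C.rename g := by
  have h₂ : C.threads.image (fun t => (t.1, f t.2)) = C.threads.image (fun t => (t.1, g t.2)) :=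
    Finset.image_congr fun t ht => by
      simp only [h (mem_data_of_mem_threads (Finset.mem_coe.1 ht))]
  simp only [rename, h C.label_mem_data, h₂]

@[simp]
theorem rename_id (C : Config A Q D) : C.rename id = C := by
  simp [rename]

theorem rename_rename (f g : D → D) (C : Config A Q D) :
    (C.rename f).rename g = C.rename (g ∘ f) := by
  simp [rename, Finset.image_image, Function.comp_def]

@[simp]
theorem rename_symm_rename (π : Equiv.Perm D) (C : Config A Q D) :
    (C.rename π).rename π.symm = C := by
  simp [rename_rename]

@[simp]
theorem rename_rename_symm (π : Equiv.Perm D) (C : Config A Q D) :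
    (C.rename π.symm).rename π = C := by
  simp [rename_rename]

theorem Incl.rename {C C' : Config A Q D} (h : C.Incl C') (f : D → D) :
    (C.rename f).Incl (C'.rename f) :=
  ⟨h.1, by simp only [Config.rename, h.2.1], Finset.image_subset_image h.2.2⟩

theorem data_rename (f : D → D) (C : Config A Q D) : (C.rename f).data = f '' C.data := by
  simp [data_eq, Config.rename, Finset.image_image, Function.comp_def, Set.image_insert_eq,
    Set.image_image]

/-- A configuration has finitely many values, so the bijection extends to a permutation. All later
arguments use this form. -/
theorem below_iff {ρ ρ' : Config A Q D} :
    ρ.Below ρ' ↔ ∃ π : Equiv.Perm D, (ρ.rename π).Incl ρ' := by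
  constructor
  · rintro ⟨ρ'', ⟨f, hf, rfl⟩, hρ⟩
    obtain ⟨π, hπ⟩ := hf.injOn.exists_perm_eqOn ρ''.finite_data
    refine ⟨π, ?_⟩
    rw [← rename_congr hπ]
    exact hρ.rename π
  · rintro ⟨π, h⟩
    refine ⟨ρ'.rename π.symm, ⟨π, ?_, by simp⟩, by simpa using h.rename π.symm⟩
    have : ρ'.data = π '' (ρ'.rename π.symm).data := by
      rw [← data_rename, rename_rename_symm]
    rw [this]
    exact π.injective.injOn.bijOn_image

theorem Below.refl (C : Config A Q D) : C.Below C :=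
  below_iff.2 ⟨Equiv.refl D, by simpa using Incl.refl C⟩

theorem Below.trans {C₁ C₂ C₃ : Config A Q D} (h : C₁.Below C₂) (h' : C₂.Below C₃) :
    C₁.Below C₃ := by
  obtain ⟨π, hπ⟩ := below_iff.1 h
  obtain ⟨π', hπ'⟩ := below_iff.1 h'
  refine below_iff.2 ⟨π.trans π', ?_⟩
  have := (hπ.rename π').trans hπ'
  rwa [rename_rename] at this

theorem Below.accepting {C C' : Config A Q D} (h : C.Below C') (h' : C'.Accepting) :
    C.Accepting := by
  obtain ⟨π, -, -, hπ⟩ := below_iff.1 h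
  rw [Accepting] at h'
  rw [h', Finset.subset_empty, rename, Finset.image_eq_empty] at hπ
  exact hπ

/-- The states of the threads with register value `e`. -/
def statesAt (C : Config A Q D) (e : D) : Finset Q :=
  (C.threads.filter fun t => t.2 = e).image Prod.fst

theorem mem_statesAt {C : Config A Q D} {e : D} {q : Q} :
    q ∈ C.statesAt e ↔ (q, e) ∈ C.threads := by
  simp [statesAt]

/-- The register values, other than the current datum, whose threads have exactly the states
`S`. -/
def valuesWith (C : Config A Q D) (S : Finset Q) : Finset D :=
  ((C.threads.image Prod.snd).erase C.label.2).filter fun e => C.statesAt e = S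

/-- Values with the same set of states are interchangeable, so an injection of each class of `C`
into the corresponding class of `C'` embeds `C` in `C'`. The current datum must go to the current
datum and is therefore kept out of the classes. -/
theorem below_of_card_valuesWith_le {C C' : Config A Q D} (htype : C.type = C'.type)
    (hletter : C.label.1 = C'.label.1)
    (hdatum : C.statesAt C.label.2 = C'.statesAt C'.label.2)
    (hcard : ∀ S, (C.valuesWith S).card ≤ (C'.valuesWith S).card) : C.Below C' := by
  have hφ : ∀ S, ∃ φ : D → D, Set.MapsTo φ (C.valuesWith S) (C'.valuesWith S) ∧
      Set.InjOn φ (C.valuesWith S) := by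
    intro S
    obtain ⟨T, hT, hcT⟩ := Finset.exists_subset_card_eq (hcard S)
    let φ := Finset.equivOfCardEq hcT.symm
    refine ⟨fun e => if h : e ∈ C.valuesWith S then φ ⟨e, h⟩ else e, ?_, ?_⟩
    · intro e he
      have he' : e ∈ C.valuesWith S := he
      simpa [he'] using hT (φ ⟨e, he'⟩).2
    · intro e he e' he' h
      have he₁ : e ∈ C.valuesWith S := he
      have he₂ : e' ∈ C.valuesWith S := he'
      simpa [he₁, he₂, Subtype.val_inj] using h
  choose φ hmaps hinj using hφ
  -- The injections of the classes are glued together. Different classes have disjoint images,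
  -- because the image of a value determines its set of states.
  let f : D → D := fun e => if e = C.label.2 then C'.label.2 else φ (C.statesAt e) e
  have hval : ∀ e ∈ C.data, e ≠ C.label.2 → e ∈ C.valuesWith (C.statesAt e) := by
    rintro e (rfl | ⟨q, hq⟩) hne
    · exact absurd rfl hne
    · simp only [valuesWith, Finset.mem_filter, Finset.mem_erase, Finset.mem_image, and_true]
      exact ⟨hne, _, hq, rfl⟩
  have hfval : ∀ e ∈ C.data, e ≠ C.label.2 → f e ∈ C'.valuesWith (C.statesAt e) := by
    intro e he hne
    simpa only [f, if_neg hne, Finset.mem_coe] using hmaps _ (hval e he hne)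
  have hfne : ∀ e ∈ C.data, e ≠ C.label.2 → f e ≠ C'.label.2 := by
    intro e he hne
    have := hfval e he hne
    simp only [valuesWith, Finset.mem_filter, Finset.mem_erase] at this
    exact this.1.1
  have hfst : ∀ e ∈ C.data, C'.statesAt (f e) = C.statesAt e := by
    intro e he
    by_cases hne : e = C.label.2
    · simp only [f, if_pos hne]
      rw [hne, hdatum]
    · have := hfval e he hne
      simp only [valuesWith, Finset.mem_filter] at this
      exact this.2
  have hfinj : C.data.InjOn f := by
    intro e he e' he' h
    by_cases h₁ : e = C.label.2
    · by_contra hne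
      refine hfne e' he' (fun h₂ => hne (h₁.trans h₂.symm)) ?_
      rw [← h]
      simp only [f, if_pos h₁]
    · by_cases h₂ : e' = C.label.2
      · refine absurd ?_ (hfne e he h₁)
        rw [h]
        simp only [f, if_pos h₂]
      · have hS : C.statesAt e = C.statesAt e' := by
          rw [← hfst e he, ← hfst e' he', h]
        refine hinj (C.statesAt e) (hval e he h₁) ?_ ?_
        · rw [hS]
          exact hval e' he' h₂
        · simp only [f, if_neg h₁, if_neg h₂] at h
          rw [h, hS]
  obtain ⟨π, hπ⟩ := hfinj.exists_perm_eqOn C.finite_data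
  refine below_iff.2 ⟨π, ?_⟩
  rw [rename_congr hπ]
  refine ⟨htype, Prod.ext hletter ?_, ?_⟩
  · simp [rename, f]
  · intro t ht
    obtain ⟨s, hs, rfl⟩ := Finset.mem_image.1 ht
    rw [← mem_statesAt, hfst _ (mem_data_of_mem_threads hs), mem_statesAt]
    exact hs

end Config

instance : Finite WordType :=
  Finite.of_injective (fun α => match α with | .hasNext => true | .isLast => false)
    (by rintro (_ | _) (_ | _) h <;> simp_all)

/-- Dickson's lemma for vectors indexed by the finite type `Finset Q`, in product with equality on a
finite type. -/
theorem Config.wellQuasiOrdered_below {A : Type v} {Q : Type w} {D : Type u} [Finite A] [Finite Q]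
    [DecidableEq Q] [DecidableEq D] :
    WellQuasiOrdered (Config.Below (A := A) (Q := Q) (D := D)) := by
  intro f
  let g : ℕ → (WordType × A × Finset Q) × (Finset Q → ℕ) := fun n =>
    (((f n).type, (f n).label.1, (f n).statesAt (f n).label.2),
      fun S => ((f n).valuesWith S).card)
  obtain ⟨m, n, hmn, h₁, h₂⟩ := ((Finite.wellQuasiOrdered
    (α := WordType × A × Finset Q) (· = ·)).prod
      (wellQuasiOrdered_le (α := Finset Q → ℕ))) g
  simp only [g, Prod.mk.injEq] at h₁
  exact ⟨m, n, hmn, Config.below_of_card_valuesWith_le h₁.1 h₁.2.1 h₁.2.2 h₂⟩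

theorem Config.isWQO_below {A : Type v} {Q : Type w} {D : Type u} [Finite A] [Finite Q]
    [DecidableEq Q] [DecidableEq D] : IsWQO (Config.Below (A := A) (Q := Q) (D := D)) :=
  ⟨Below.refl, fun _ _ _ => Below.trans, wellQuasiOrdered_below⟩

/-! ### Transitions up to inclusion, and compatibility with the order. -/

namespace ARA

variable {A : Type v} {Q : Type w} {D : Type u} [DecidableEq Q] [DecidableEq D]

/-- `M.Effect α γ Δ t X`: at a position with type `α` and label `γ`, executing the instruction of
the thread `t ∈ Δ` replaces `t` by the threads in `X`. -/
def Effect (M : ARA A Q) (α : WordType) (γ : A × D) (Δ : Finset (Q × D)) (t : Q × D)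
    (X : Finset (Q × D)) : Prop :=
  match M.δ t.1 with
  | .letter b => b = γ.1 ∧ X = ∅
  | .notLetter b => b ≠ γ.1 ∧ X = ∅
  | .test β => β = α ∧ X = ∅
  | .store q => X = {(q, γ.2)}
  | .eq => γ.2 = t.2 ∧ X = ∅
  | .neq => γ.2 ≠ t.2 ∧ X = ∅
  | .and q₁ q₂ => X = {(q₁, t.2), (q₂, t.2)}
  | .or q₁ q₂ => X = {(q₁, t.2)} ∨ X = {(q₂, t.2)}
  | .move _ => False
  | .guess q => ∃ e, X = {(q, e)}
  | .spread q₂ q₁ => (∀ s ∈ Δ.erase t, (M.δ s.1).IsSpread ∨ (M.δ s.1).IsMoving) ∧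
      X = ((Δ.erase t).filter fun s => s.1 = q₂).image fun s => (q₁, s.2)

/-- Among the decompositions `insert t Δ` allowed by `StepEps`, this is the one in which `Δ` does
not contain `t`. -/
theorem Effect.stepEps {M : ARA A Q} {C : Config A Q D} {t : Q × D} {X : Finset (Q × D)}
    (ht : t ∈ C.threads) (h : M.Effect C.type C.label C.threads t X) :
    M.StepEps C ⟨C.pos, C.type, C.label, X ∪ C.threads.erase t⟩ := by
  obtain ⟨i, α, ⟨a, d⟩, Δ⟩ := C
  obtain ⟨q, e⟩ := t
  dsimp only at ht h ⊢
  obtain ⟨Δ', hΔ', hE⟩ : ∃ Δ', Δ' = Δ.erase (q, e) ∧ Δ = insert (q, e) Δ' :=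
    ⟨_, rfl, (Finset.insert_erase ht).symm⟩
  unfold Effect at h
  rw [← hΔ'] at h ⊢
  rw [hE]
  clear hE hΔ' ht
  split at h
  case h_1 b hδ => obtain ⟨h, rfl⟩ := h; simpa using StepEps.letter hδ h
  case h_2 b hδ => obtain ⟨h, rfl⟩ := h; simpa using StepEps.notLetter hδ h
  case h_3 b hδ => obtain ⟨h, rfl⟩ := h; simpa using StepEps.test hδ h
  case h_4 q' hδ => subst h; rw [← Finset.insert_eq]; exact StepEps.store hδ
  case h_5 hδ => obtain ⟨h, rfl⟩ := h; simpa using StepEps.eq hδ h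
  case h_6 hδ => obtain ⟨h, rfl⟩ := h; simpa using StepEps.neq hδ h
  case h_7 q₁ q₂ hδ => subst h; exact StepEps.and hδ
  case h_8 q₁ q₂ hδ =>
    obtain rfl | rfl := h
    · rw [← Finset.insert_eq]; exact StepEps.or_left hδ
    · rw [← Finset.insert_eq]; exact StepEps.or_right hδ
  case h_9 => exact h.elim
  case h_10 q' hδ => obtain ⟨e', rfl⟩ := h; rw [← Finset.insert_eq]; exact StepEps.guess hδ e'
  case h_11 q₂ q₁ hδ => obtain ⟨h, rfl⟩ := h; exact StepEps.spread hδ h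

/-- In a transition from `insert t Δ`, the set `Δ` may still contain `t`, and then `t` survives.
Removing it gives a smaller result, and an inclusion is all that compatibility and the simulation by
codes need. -/
theorem StepEps.exists_effect {M : ARA A Q} {C C' : Config A Q D} (h : M.StepEps C C') :
    C'.pos = C.pos ∧ C'.type = C.type ∧ C'.label = C.label ∧
      ∃ t ∈ C.threads, ∃ X, M.Effect C.type C.label C.threads t X ∧
        X ∪ C.threads.erase t ⊆ C'.threads := by
  have key : ∀ {t : Q × D} {Δ X : Finset (Q × D)}, X ∪ (insert t Δ).erase t ⊆ X ∪ Δ :=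
    fun {t Δ X} => Finset.union_subset_union_right (Finset.erase_insert_subset t Δ)
  have key' : ∀ {t : Q × D} {Δ : Finset (Q × D)}, ∅ ∪ (insert t Δ).erase t ⊆ Δ :=
    fun {t Δ} => by simpa using Finset.erase_insert_subset t Δ
  have key'' : ∀ {t x : Q × D} {Δ : Finset (Q × D)}, {x} ∪ (insert t Δ).erase t ⊆ insert x Δ :=
    fun {t x Δ} => by rw [Finset.insert_eq x]; exact key
  cases h with
  | @or_left _ _ _ _ e _ q₁ _ h =>
    exact ⟨rfl, rfl, rfl, _, Finset.mem_insert_self _ _, {(q₁, e)}, by simp [Effect, h], key''⟩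
  | @or_right _ _ _ _ e _ _ q₂ h =>
    exact ⟨rfl, rfl, rfl, _, Finset.mem_insert_self _ _, {(q₂, e)}, by simp [Effect, h], key''⟩
  | @and _ _ _ _ e _ q₁ q₂ h =>
    exact ⟨rfl, rfl, rfl, _, Finset.mem_insert_self _ _, {(q₁, e), (q₂, e)},
      by simp [Effect, h], key⟩
  | @store _ _ _ d _ _ _ q' h =>
    exact ⟨rfl, rfl, rfl, _, Finset.mem_insert_self _ _, {(q', d)}, by simp [Effect, h], key''⟩
  | @guess _ _ _ _ _ _ q' h e' =>
    exact ⟨rfl, rfl, rfl, _, Finset.mem_insert_self _ _, {(q', e')}, by simp [Effect, h], key''⟩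
  | eq h hd =>
    exact ⟨rfl, rfl, rfl, _, Finset.mem_insert_self _ _, ∅, by simp [Effect, h, hd], key'⟩
  | neq h hd =>
    exact ⟨rfl, rfl, rfl, _, Finset.mem_insert_self _ _, ∅, by simp [Effect, h, hd], key'⟩
  | test h hd =>
    exact ⟨rfl, rfl, rfl, _, Finset.mem_insert_self _ _, ∅, by simp [Effect, h, hd], key'⟩
  | letter h hd =>
    exact ⟨rfl, rfl, rfl, _, Finset.mem_insert_self _ _, ∅, by simp [Effect, h, hd], key'⟩
  | notLetter h hd =>
    exact ⟨rfl, rfl, rfl, _, Finset.mem_insert_self _ _, ∅, by simp [Effect, h, hd], key'⟩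
  | @spread _ _ _ q e Δ q₂ q₁ h hΔ =>
    refine ⟨rfl, rfl, rfl, _, Finset.mem_insert_self _ _,
      (((insert (q, e) Δ).erase (q, e)).filter fun s => s.1 = q₂).image fun s => (q₁, s.2), ?_, ?_⟩
    · simp only [Effect, h, and_true]
      exact fun s hs => hΔ s (Finset.erase_insert_subset _ _ hs)
    · exact Finset.union_subset_union (Finset.image_subset_image
        (Finset.filter_subset_filter _ (Finset.erase_insert_subset _ _)))
        (Finset.erase_insert_subset _ _)

/-- Only `spread` looks at the other threads. With fewer of them its condition is easier to meet and
it creates fewer threads. -/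
theorem Effect.mono {M : ARA A Q} {α : WordType} {γ : A × D} {Δ Δ' : Finset (Q × D)} {t : Q × D}
    {X : Finset (Q × D)} (h : M.Effect α γ Δ t X) (hΔ : Δ' ⊆ Δ) :
    ∃ X' ⊆ X, M.Effect α γ Δ' t X' := by
  unfold Effect at h ⊢
  split at h
  case h_11 q₂ q₁ hδ =>
    obtain ⟨h, rfl⟩ := h
    exact ⟨_, Finset.image_subset_image (Finset.filter_subset_filter _
      (Finset.erase_subset_erase t hΔ)),
      fun s hs => h s (Finset.erase_subset_erase t hΔ hs), rfl⟩
  all_goals exact ⟨X, Finset.Subset.refl _, h⟩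

/-- If `B` contains the fired thread, it fires it too. If not, the fired thread is the only one that
may disappear, so `B` is already included in the result. -/
theorem StepEps.exists_of_incl {M : ARA A Q} {C C' B : Config A Q D} (h : M.StepEps C C')
    (hB : B.Incl C) : ∃ B', B'.Incl C' ∧ (M.StepEps B B' ∨ B = B') := by
  obtain ⟨-, htype, hlabel, t, -, X, hX, hsub⟩ := h.exists_effect
  by_cases htB : t ∈ B.threads
  · obtain ⟨X', hX', hE⟩ := hX.mono hB.2.2
    rw [← hB.1, ← hB.2.1] at hE
    exact ⟨⟨B.pos, B.type, B.label, X' ∪ B.threads.erase t⟩,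
      ⟨hB.1.trans htype.symm, hB.2.1.trans hlabel.symm,
        (Finset.union_subset_union hX' (Finset.erase_subset_erase t hB.2.2)).trans hsub⟩,
      .inl (hE.stepEps htB)⟩
  · exact ⟨B, ⟨hB.1.trans htype.symm, hB.2.1.trans hlabel.symm, fun s hs => hsub
      (Finset.mem_union_right _ (Finset.mem_erase.2 ⟨fun h => htB (h ▸ hs), hB.2.2 hs⟩))⟩, .inr rfl⟩

/-- The threads after a moving transition. -/
noncomputable def movedThreads (M : ARA A Q) (Δ : Finset (Q × D)) : Finset (Q × D) :=
  Δ.biUnion fun t => match M.δ t.1 with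
    | .move q => {(q, t.2)}
    | _ => ∅

theorem mem_movedThreads {M : ARA A Q} {Δ : Finset (Q × D)} {t : Q × D} :
    t ∈ M.movedThreads Δ ↔ ∃ q, (q, t.2) ∈ Δ ∧ M.δ q = .move t.1 := by
  simp only [movedThreads, Finset.mem_biUnion]
  constructor
  · rintro ⟨s, hs, h⟩
    split at h
    · rename_i q hq
      obtain rfl := Finset.mem_singleton.1 h
      exact ⟨s.1, hs, hq⟩
    · simp at h
  · rintro ⟨q, hq, h⟩
    exact ⟨_, hq, by simp [h]⟩

theorem StepMove.exists_of_incl {M : ARA A Q} {C C' B : Config A Q D} (h : M.StepMove C C')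
    (hB : B.Incl C) : ∃ B', B'.Incl C' ∧ M.StepMove B B' := by
  cases h with
  | @mk i γ Δ α' γ' Δ' hmov hΔ =>
    obtain ⟨j, α, γ'', Δ''⟩ := B
    obtain ⟨h₁, h₂, hsub⟩ := hB
    dsimp only at h₁ h₂ hsub
    subst h₁ h₂
    refine ⟨⟨j + 1, α', γ', M.movedThreads Δ''⟩, ⟨rfl, rfl, ?_⟩,
      .mk (α' := α') (γ' := γ') (fun t ht => hmov t (hsub ht)) fun t => mem_movedThreads⟩
    intro t ht
    obtain ⟨q, hq, h⟩ := mem_movedThreads.1 ht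
    exact (hΔ t).2 ⟨q, hsub hq, h⟩

theorem Step.exists_of_incl {M : ARA A Q} {C C' B : Config A Q D} (h : M.Step C C')
    (hB : B.Incl C) : ∃ B', B'.Incl C' ∧ (M.Step B B' ∨ B = B') := by
  obtain h | h := h
  · obtain ⟨B', h₁, h₂⟩ := h.exists_of_incl hB
    exact ⟨B', h₁, .inl (.inl h₂)⟩
  · obtain ⟨B', h₁, h₂⟩ := h.exists_of_incl hB
    exact ⟨B', h₁, h₂.imp_left .inr⟩

theorem StepEps.rename {M : ARA A Q} {C C' : Config A Q D} (h : M.StepEps C C')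
    (π : Equiv.Perm D) : M.StepEps (C.rename π) (C'.rename π) := by
  cases h with
  | or_left h => simpa [Config.rename, Finset.image_insert] using StepEps.or_left h
  | or_right h => simpa [Config.rename, Finset.image_insert] using StepEps.or_right h
  | and h =>
    simpa [Config.rename, Finset.image_insert, Finset.image_union] using StepEps.and h
  | store h => simpa [Config.rename, Finset.image_insert] using StepEps.store h
  | eq h hd =>
    simpa [Config.rename, Finset.image_insert] using StepEps.eq h (congrArg π hd)
  | neq h hd =>
    simpa [Config.rename, Finset.image_insert] using StepEps.neq h (π.injective.ne hd)
  | test h hd => simpa [Config.rename, Finset.image_insert] using StepEps.test h hd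
  | letter h hd => simpa [Config.rename, Finset.image_insert] using StepEps.letter h hd
  | notLetter h hd => simpa [Config.rename, Finset.image_insert] using StepEps.notLetter h hd
  | guess h e' => simpa [Config.rename, Finset.image_insert] using StepEps.guess h (π e')
  | @spread i α γ q e Δ q₂ q₁ h hΔ =>
    have := StepEps.spread (i := i) (α := α) (γ := (γ.1, π γ.2)) (e := π e)
      (Δ := Δ.image fun t => (t.1, π t.2)) h (fun t ht => by
        obtain ⟨s, hs, rfl⟩ := Finset.mem_image.1 ht
        exact hΔ s hs)
    simpa [Config.rename, Finset.image_insert, Finset.image_union, Finset.filter_image,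
      Finset.image_image, Function.comp_def] using this

theorem StepMove.rename {M : ARA A Q} {C C' : Config A Q D} (h : M.StepMove C C')
    (π : Equiv.Perm D) : M.StepMove (C.rename π) (C'.rename π) := by
  have key : ∀ (Δ : Finset (Q × D)) (t : Q × D),
      t ∈ Δ.image (fun s => (s.1, π s.2)) ↔ (t.1, π.symm t.2) ∈ Δ := by
    intro Δ t
    simp only [Finset.mem_image]
    constructor
    · rintro ⟨s, hs, rfl⟩
      simpa using hs
    · exact fun h => ⟨_, h, by simp⟩
  cases h with
  | mk hmov hΔ =>
    refine .mk (fun t ht => ?_) (fun t => ?_)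
    · exact hmov (t.1, π.symm t.2) ((key _ _).1 ht)
    · simp only [key, hΔ]

theorem Step.rename {M : ARA A Q} {C C' : Config A Q D} (h : M.Step C C')
    (π : Equiv.Perm D) : M.Step (C.rename π) (C'.rename π) :=
  h.imp (·.rename π) (·.rename π)

/-- The smaller configuration is moved inside the larger one by a permutation, matched there, and
moved back. -/
theorem isRDC_step (M : ARA A Q) : IsRDC (M.Step (D := D)) Config.Below := by
  intro C C' B hB h
  obtain ⟨π, hπ⟩ := Config.below_iff.1 hB
  obtain ⟨B', hB', hs⟩ := h.exists_of_incl hπ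
  refine ⟨B'.rename π.symm, Config.below_iff.2 ⟨π, by simpa using hB'⟩, ?_⟩
  obtain hs | rfl := hs
  · exact .inl (by simpa using hs.rename π.symm)
  · exact .inr (by simp)

/-! ### Emptiness as unreachability of accepting configurations. -/

/-- The configuration is reachable from an initial one. -/
def Reachable (M : ARA A Q) (C : Config A Q D) : Prop :=
  ∃ α γ, Relation.ReflTransGen M.Step ⟨0, α, γ, {(M.start, γ.2)}⟩ C

theorem Reachable.step {M : ARA A Q} {C C' : Config A Q D} (h : M.Reachable C)
    (h' : M.Step C C') : M.Reachable C' := by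
  obtain ⟨α, γ, h⟩ := h
  exact ⟨α, γ, h.tail h'⟩

theorem Reachable.rename {M : ARA A Q} {C : Config A Q D} (h : M.Reachable C)
    (π : Equiv.Perm D) : M.Reachable (C.rename π) := by
  obtain ⟨α, γ, h⟩ := h
  refine ⟨α, (γ.1, π γ.2), ?_⟩
  have := h.lift (p := M.Step) (Config.rename π) fun _ _ hs => hs.rename π
  simpa [Function.onFun, Config.rename] using this

/-- The word can be read off a path: non-moving transitions keep position, type and label, and each
move appends one letter. The prefix `p` holds the letters already passed; it is arbitrary so that
the induction can start from the head of the path. -/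
theorem exists_word_of_reflTransGen {M : ARA A Q} {C C' : Config A Q D}
    (h : Relation.ReflTransGen M.Step C C') : ∀ p : List (A × D), p.length = C.pos →
      ∃ y r, (C :: r).IsChain M.Step ∧ (∀ B ∈ C :: r, B.Fits (p ++ y)) ∧
        (C :: r).getLast? = some C' := by
  induction h using Relation.ReflTransGen.head_induction_on with
  | refl =>
    intro p hp
    cases hα : C'.type with
    | hasNext =>
      -- The type promises a next position, so one more letter is needed; which one is irrelevant.
      exact ⟨[C'.label, C'.label], [], by simp, by simp [Config.Fits, hα, ← hp], by simp⟩
    | isLast => exact ⟨[C'.label], [], by simp, by simp [Config.Fits, hα, ← hp], by simp⟩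
  | @head C B hs _ ih =>
    intro p hp
    obtain hs | hs := hs
    · have hs' := hs
      cases hs with
      | @mk i γ Δ α' γ' Δ' hmov hΔ =>
        simp only at hp
        obtain ⟨y, r, hr, hf, hl⟩ := ih (p ++ [γ]) (by simp [hp])
        refine ⟨γ :: y, _ :: r, List.isChain_cons_cons.2 ⟨.inl hs', hr⟩, ?_, by simpa using hl⟩
        -- Since `B` fits the word at position `i + 1`, that position exists, as the type of the
        -- configuration before the move requires.
        have hB := hf _ List.mem_cons_self
        intro B' hB'
        obtain rfl | hB' := List.mem_cons.1 hB'
        · obtain ⟨h₁, -⟩ := hB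
          obtain ⟨h₁, -⟩ := List.getElem?_eq_some_iff.1 h₁
          refine ⟨by simp [← hp], by simpa using h₁⟩
        · simpa using hf B' hB'
    · obtain ⟨hpos, htype, hlabel, -⟩ := hs.exists_effect
      obtain ⟨y, r, hr, hf, hl⟩ := ih p (hp.trans hpos.symm)
      refine ⟨y, B :: r, List.isChain_cons_cons.2 ⟨.inr hs, hr⟩, ?_, by simpa using hl⟩
      intro B' hB'
      obtain rfl | hB' := List.mem_cons.1 hB'
      · have := hf B List.mem_cons_self
        rwa [Config.Fits, hpos, htype, hlabel] at this
      · exact hf B' hB'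

theorem language_eq_empty_iff (M : ARA A Q) :
    M.language D = ∅ ↔ ∀ C : Config A Q D, M.Reachable C → ¬ C.Accepting := by
  rw [Set.eq_empty_iff_forall_notMem]
  constructor
  · rintro h C ⟨α, γ, hC⟩ hacc
    obtain ⟨y, r, hr, hf, hl⟩ := exists_word_of_reflTransGen hC [] rfl
    exact h _ ⟨_, ⟨⟨α, γ, rfl⟩, hr, hf⟩, C, hl, hacc⟩
  · rintro h x ⟨r, ⟨⟨α, γ, hhead⟩, hr, -⟩, C, hl, hacc⟩
    refine h C ⟨α, γ, ?_⟩ hacc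
    obtain ⟨r, rfl⟩ : ∃ r', r = ⟨0, α, γ, {(M.start, γ.2)}⟩ :: r' := by
      cases r with
      | nil => simp at hhead
      | cons a r => exact ⟨r, by simpa using hhead⟩
    rw [List.getLast?_eq_some_getLast (by simp)] at hl
    have := List.relationReflTransGen_of_exists_isChain_cons r hr (Option.some_inj.1 hl)
    exact this

end ARA

/-! ### Bounded quantifiers and filters over lists are primitive recursive. -/

section PrimrecQuantifiers

variable {α β : Type*} [Primcodable α] [Primcodable β]

theorem PrimrecPred.forall_mem_comp {p : α → β → Prop} {f : α → List β} (hf : Primrec f)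
    (hp : PrimrecPred fun x : α × β => p x.1 x.2) : PrimrecPred fun a => ∀ b ∈ f a, p a b :=
  have hR : PrimrecRel fun b a => p a b := hp.comp (Primrec.snd.pair Primrec.fst)
  hR.forall_mem_list.comp hf Primrec.id

theorem PrimrecPred.exists_mem_comp {p : α → β → Prop} {f : α → List β} (hf : Primrec f)
    (hp : PrimrecPred fun x : α × β => p x.1 x.2) : PrimrecPred fun a => ∃ b ∈ f a, p a b :=
  have hR : PrimrecRel fun b a => p a b := hp.comp (Primrec.snd.pair Primrec.fst)
  hR.exists_mem_list.comp hf Primrec.id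

theorem Primrec.list_filter_comp {p : α → β → Prop} [∀ a, DecidablePred (p a)] {f : α → List β}
    (hf : Primrec f) (hp : PrimrecPred fun x : α × β => p x.1 x.2) :
    Primrec fun a => (f a).filter fun b => p a b := by
  have hR : PrimrecRel fun b a => p a b := hp.comp (Primrec.snd.pair Primrec.fst)
  let _ : DecidableRel fun b a => p a b := fun b a => inferInstanceAs (Decidable (p a b))
  exact hR.listFilter.comp hf Primrec.id

theorem PrimrecPred.mem_list [DecidableEq β] {f : α → β} {g : α → List β} (hf : Primrec f)
    (hg : Primrec g) : PrimrecPred fun a => f a ∈ g a :=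
  (PrimrecPred.exists_mem_comp (p := fun a b => b = f a) hg
    (Primrec.eq.comp Primrec.snd (hf.comp Primrec.fst))).of_eq fun a => by simp

end PrimrecQuantifiers

/-! ### Coded configurations and their computable successors. -/

/-- A configuration with numbers for the type, the letter, the states and the data values. -/
abbrev CodedConfig := ℕ × ℕ × ℕ × List (ℕ × ℕ)

namespace CodedConfig

abbrev type (c : CodedConfig) : ℕ := c.1

abbrev letter (c : CodedConfig) : ℕ := c.2.1

abbrev datum (c : CodedConfig) : ℕ := c.2.2.1

abbrev threads (c : CodedConfig) : List (ℕ × ℕ) := c.2.2.2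

theorem primrec_type : Primrec type := Primrec.fst

theorem primrec_letter : Primrec letter := Primrec.fst.comp Primrec.snd

theorem primrec_datum : Primrec datum := Primrec.fst.comp (Primrec.snd.comp Primrec.snd)

theorem primrec_threads : Primrec threads := Primrec.snd.comp (Primrec.snd.comp Primrec.snd)

/-- The data values that occur in a coded configuration. -/
def data (c : CodedConfig) : Set ℕ := {e | e = c.datum ∨ ∃ s ∈ c.threads, s.2 = e}

/-- Inclusion of the threads, with the same type and label. -/
def Incl (c c' : CodedConfig) : Prop :=
  c.type = c'.type ∧ c.letter = c'.letter ∧ c.datum = c'.datum ∧ ∀ s ∈ c.threads, s ∈ c'.threads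

theorem primrecPred_incl : PrimrecPred fun x : CodedConfig × CodedConfig => x.1.Incl x.2 :=
  (Primrec.eq.comp (primrec_type.comp Primrec.fst) (primrec_type.comp Primrec.snd)).and <|
  (Primrec.eq.comp (primrec_letter.comp Primrec.fst) (primrec_letter.comp Primrec.snd)).and <|
  (Primrec.eq.comp (primrec_datum.comp Primrec.fst) (primrec_datum.comp Primrec.snd)).and <|
  PrimrecPred.forall_mem_comp (p := fun (x : CodedConfig × CodedConfig) s => s ∈ x.2.threads)
    (primrec_threads.comp Primrec.fst)
    (PrimrecPred.mem_list Primrec.snd (primrec_threads.comp (Primrec.snd.comp Primrec.fst)))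

/-- The coded instruction of the state `q` in the table `T`. -/
def instr (T : List (ℕ × ℕ × ℕ)) (q : ℕ) : ℕ × ℕ × ℕ := T.getD q (0, 0, 0)

theorem primrec_instr : Primrec fun x : List (ℕ × ℕ × ℕ) × ℕ => instr x.1 x.2 :=
  (Primrec.list_getD (0, 0, 0)).comp Primrec.fst Primrec.snd

/-- The coded instruction `φ` is a test that succeeds for the register value `e` in `c`. -/
def TestSucceeds (c : CodedConfig) (φ : ℕ × ℕ × ℕ) (e : ℕ) : Prop :=
  (φ.1 = 0 ∧ φ.2.1 = c.letter) ∨ (φ.1 = 1 ∧ φ.2.1 ≠ c.letter) ∨ (φ.1 = 2 ∧ φ.2.1 = c.type) ∨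
    (φ.1 = 4 ∧ c.datum = e) ∨ (φ.1 = 5 ∧ c.datum ≠ e)

instance (c : CodedConfig) (φ : ℕ × ℕ × ℕ) (e : ℕ) : Decidable (c.TestSucceeds φ e) :=
  inferInstanceAs (Decidable (_ ∨ _))

theorem primrecPred_testSucceeds :
    PrimrecPred fun x : CodedConfig × (ℕ × ℕ × ℕ) × ℕ => x.1.TestSucceeds x.2.1 x.2.2 := by
  have htag : Primrec fun x : CodedConfig × (ℕ × ℕ × ℕ) × ℕ => x.2.1.1 :=
    Primrec.fst.comp (Primrec.fst.comp Primrec.snd)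
  have harg : Primrec fun x : CodedConfig × (ℕ × ℕ × ℕ) × ℕ => x.2.1.2.1 :=
    Primrec.fst.comp (Primrec.snd.comp (Primrec.fst.comp Primrec.snd))
  have he : Primrec fun x : CodedConfig × (ℕ × ℕ × ℕ) × ℕ => x.2.2 := Primrec.snd.comp Primrec.snd
  have tag (m : ℕ) : PrimrecPred fun x : CodedConfig × (ℕ × ℕ × ℕ) × ℕ => x.2.1.1 = m :=
    Primrec.eq.comp htag (Primrec.const m)
  exact ((tag 0).and (Primrec.eq.comp harg (primrec_letter.comp Primrec.fst))).or <|
    ((tag 1).and (Primrec.eq.comp harg (primrec_letter.comp Primrec.fst)).not).or <|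
    ((tag 2).and (Primrec.eq.comp harg (primrec_type.comp Primrec.fst))).or <|
    ((tag 4).and (Primrec.eq.comp (primrec_datum.comp Primrec.fst) he)).or <|
    (tag 5).and (Primrec.eq.comp (primrec_datum.comp Primrec.fst) he).not

/-- The lists of threads by which a non-moving transition of `c` may replace the thread `t`, when
the guessed values are taken from `V`. -/
def replacements (T : List (ℕ × ℕ × ℕ)) (V : List ℕ) (c : CodedConfig) (t : ℕ × ℕ) :
    List (List (ℕ × ℕ)) :=
  if c.TestSucceeds (instr T t.1) t.2 then [[]]
  else if (instr T t.1).1 = 3 then [[((instr T t.1).2.1, c.datum)]]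
  else if (instr T t.1).1 = 6 then [[((instr T t.1).2.1, t.2), ((instr T t.1).2.2, t.2)]]
  else if (instr T t.1).1 = 7 then [[((instr T t.1).2.1, t.2)], [((instr T t.1).2.2, t.2)]]
  else if (instr T t.1).1 = 9 then V.map fun v => [((instr T t.1).2.1, v)]
  else if (instr T t.1).1 = 10 ∧
      ∀ s ∈ c.threads, s = t ∨ (instr T s.1).1 = 10 ∨ (instr T s.1).1 = 8 then
    [(c.threads.filter fun s => s ≠ t ∧ s.1 = (instr T t.1).2.1).map
      fun s => ((instr T t.1).2.2, s.2)]
  else []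

theorem primrec_replacements : Primrec fun x : (List (ℕ × ℕ × ℕ) × List ℕ) × CodedConfig × ℕ × ℕ =>
    replacements x.1.1 x.1.2 x.2.1 x.2.2 := by
  have hT : Primrec fun x : (List (ℕ × ℕ × ℕ) × List ℕ) × CodedConfig × ℕ × ℕ => x.1.1 :=
    Primrec.fst.comp Primrec.fst
  have hV : Primrec fun x : (List (ℕ × ℕ × ℕ) × List ℕ) × CodedConfig × ℕ × ℕ => x.1.2 :=
    Primrec.snd.comp Primrec.fst
  have hc : Primrec fun x : (List (ℕ × ℕ × ℕ) × List ℕ) × CodedConfig × ℕ × ℕ => x.2.1 :=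
    Primrec.fst.comp Primrec.snd
  have ht : Primrec fun x : (List (ℕ × ℕ × ℕ) × List ℕ) × CodedConfig × ℕ × ℕ => x.2.2 :=
    Primrec.snd.comp Primrec.snd
  have he := Primrec.snd.comp ht
  have hφ := primrec_instr.comp (hT.pair (Primrec.fst.comp ht))
  have htag := Primrec.fst.comp hφ
  have hx := Primrec.fst.comp (Primrec.snd.comp hφ)
  have hy := Primrec.snd.comp (Primrec.snd.comp hφ)
  have tag (m : ℕ) := Primrec.eq.comp htag (Primrec.const m)
  have single : Primrec fun s : ℕ × ℕ => [s] := Primrec.list_cons.comp Primrec.id (Primrec.const [])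
  have single' : Primrec fun s : List (ℕ × ℕ) => [s] :=
    Primrec.list_cons.comp Primrec.id (Primrec.const [])
  refine Primrec.ite (primrecPred_testSucceeds.comp (hc.pair (hφ.pair he))) (Primrec.const [[]]) ?_
  refine Primrec.ite (tag 3) (single'.comp (single.comp (hx.pair (primrec_datum.comp hc)))) ?_
  refine Primrec.ite (tag 6)
    (single'.comp (Primrec.list_cons.comp (hx.pair he) (single.comp (hy.pair he)))) ?_
  refine Primrec.ite (tag 7) (Primrec.list_cons.comp (single.comp (hx.pair he))
    (single'.comp (single.comp (hy.pair he)))) ?_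
  refine Primrec.ite (tag 9) (Primrec.list_map hV
    (single.comp ((hx.comp Primrec.fst).pair Primrec.snd)).to₂) ?_
  have htag' := Primrec.fst.comp (primrec_instr.comp
    ((hT.comp (Primrec.fst (β := ℕ × ℕ))).pair (Primrec.fst.comp Primrec.snd)))
  refine Primrec.ite ((tag 10).and (PrimrecPred.forall_mem_comp (primrec_threads.comp hc)
    ((Primrec.eq.comp Primrec.snd (ht.comp Primrec.fst)).or
      ((Primrec.eq.comp htag' (Primrec.const 10)).or (Primrec.eq.comp htag' (Primrec.const 8))))))
    (single'.comp (Primrec.list_map (Primrec.list_filter_comp (primrec_threads.comp hc)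
      ((Primrec.eq.comp Primrec.snd (ht.comp Primrec.fst)).not.and
        (Primrec.eq.comp (Primrec.fst.comp Primrec.snd) (hx.comp Primrec.fst))))
      ((hy.comp Primrec.fst).pair (Primrec.snd.comp Primrec.snd)).to₂)) (Primrec.const [])

/-- The coded configurations with type, letter below `k` and datum from `V`, and threads `Δ`. -/
def withLabels (k : ℕ) (V : List ℕ) (Δ : List (ℕ × ℕ)) : List CodedConfig :=
  [0, 1].flatMap fun α => (List.range k).flatMap fun a => V.map fun v => (α, a, v, Δ)

theorem mem_withLabels {k : ℕ} {V : List ℕ} {Δ : List (ℕ × ℕ)} {c : CodedConfig} :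
    c ∈ withLabels k V Δ ↔
      (c.type = 0 ∨ c.type = 1) ∧ c.letter < k ∧ c.datum ∈ V ∧ c.threads = Δ := by
  obtain ⟨α, a, d, Δ'⟩ := c
  simp only [withLabels, List.mem_flatMap, List.mem_map, List.mem_range, List.mem_cons,
    List.not_mem_nil, or_false, Prod.mk.injEq]
  constructor
  · rintro ⟨α', hα, a', ha, v, hv, rfl, rfl, rfl, rfl⟩
    exact ⟨hα, ha, hv, rfl⟩
  · rintro ⟨hα, ha, hv, rfl⟩
    exact ⟨α, hα, a, ha, d, hv, rfl, rfl, rfl, rfl⟩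

theorem primrec_withLabels :
    Primrec fun x : ℕ × List ℕ × List (ℕ × ℕ) => withLabels x.1 x.2.1 x.2.2 := by
  refine Primrec.list_flatMap (Primrec.const [0, 1]) (Primrec₂.mk ?_)
  refine Primrec.list_flatMap (Primrec.list_range.comp (Primrec.fst.comp Primrec.fst))
    (Primrec₂.mk ?_)
  refine Primrec.list_map (Primrec.fst.comp (Primrec.snd.comp (Primrec.fst.comp Primrec.fst)))
    (Primrec₂.mk ?_)
  exact (Primrec.snd.comp (Primrec.fst.comp Primrec.fst)).pair
    ((Primrec.snd.comp Primrec.fst).pair (Primrec.snd.pair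
      (Primrec.snd.comp (Primrec.snd.comp (Primrec.fst.comp (Primrec.fst.comp Primrec.fst))))))

/-- The coded configurations after the non-moving transitions of `c`. -/
def epsSuccessors (T : List (ℕ × ℕ × ℕ)) (V : List ℕ) (c : CodedConfig) : List CodedConfig :=
  c.threads.flatMap fun t => (replacements T V c t).map fun X =>
    (c.type, c.letter, c.datum, X ++ c.threads.filter fun s => s ≠ t)

/-- The coded configurations after the moving transitions of `c`. -/
def moveSuccessors (k : ℕ) (T : List (ℕ × ℕ × ℕ)) (V : List ℕ) (c : CodedConfig) :
    List CodedConfig :=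
  if c.type = 0 ∧ ∀ s ∈ c.threads, (instr T s.1).1 = 8 then
    withLabels k V (c.threads.map fun s => ((instr T s.1).2.1, s.2))
  else []

/-- The coded configurations after the transitions of `c`, when new data are taken from `V`. -/
def successors (k : ℕ) (T : List (ℕ × ℕ × ℕ)) (V : List ℕ) (c : CodedConfig) : List CodedConfig :=
  epsSuccessors T V c ++ moveSuccessors k T V c

theorem primrec_epsSuccessors : Primrec fun x : (List (ℕ × ℕ × ℕ) × List ℕ) × CodedConfig =>
    epsSuccessors x.1.1 x.1.2 x.2 := by
  have hc : Primrec fun x : (((List (ℕ × ℕ × ℕ) × List ℕ) × CodedConfig) × (ℕ × ℕ)) ×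
      List (ℕ × ℕ) => x.1.1.2 := Primrec.snd.comp (Primrec.fst.comp Primrec.fst)
  refine Primrec.list_flatMap (primrec_threads.comp Primrec.snd) (Primrec₂.mk ?_)
  refine Primrec.list_map (primrec_replacements.comp ((Primrec.fst.comp Primrec.fst).pair
    ((Primrec.snd.comp Primrec.fst).pair Primrec.snd))) (Primrec₂.mk ?_)
  refine (primrec_type.comp hc).pair ((primrec_letter.comp hc).pair ((primrec_datum.comp hc).pair
    (Primrec.list_append.comp Primrec.snd (Primrec.list_filter_comp (primrec_threads.comp hc) ?_))))
  exact (Primrec.eq.comp Primrec.snd (Primrec.snd.comp (Primrec.fst.comp Primrec.fst))).not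

theorem primrec_moveSuccessors :
    Primrec fun x : ℕ × (List (ℕ × ℕ × ℕ) × List ℕ) × CodedConfig =>
      moveSuccessors x.1 x.2.1.1 x.2.1.2 x.2.2 := by
  have hc : Primrec fun x : ℕ × (List (ℕ × ℕ × ℕ) × List ℕ) × CodedConfig => x.2.2 :=
    Primrec.snd.comp Primrec.snd
  have hT : Primrec fun x : ℕ × (List (ℕ × ℕ × ℕ) × List ℕ) × CodedConfig => x.2.1.1 :=
    Primrec.fst.comp (Primrec.fst.comp Primrec.snd)
  have hφ := primrec_instr.comp
    ((hT.comp (Primrec.fst (β := ℕ × ℕ))).pair (Primrec.fst.comp Primrec.snd))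
  refine Primrec.ite ((Primrec.eq.comp (primrec_type.comp hc) (Primrec.const 0)).and
    (PrimrecPred.forall_mem_comp (primrec_threads.comp hc)
      (Primrec.eq.comp (Primrec.fst.comp hφ) (Primrec.const 8))))
    (primrec_withLabels.comp (Primrec.fst.pair
      ((Primrec.snd.comp (Primrec.fst.comp Primrec.snd)).pair
        (Primrec.list_map (primrec_threads.comp hc) ?_)))) (Primrec.const [])
  exact ((Primrec.fst.comp (Primrec.snd.comp hφ)).pair (Primrec.snd.comp Primrec.snd)).to₂

theorem primrec_successors : Primrec fun x : ℕ × (List (ℕ × ℕ × ℕ) × List ℕ) × CodedConfig =>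
    successors x.1 x.2.1.1 x.2.1.2 x.2.2 :=
  Primrec.list_append.comp (primrec_epsSuccessors.comp Primrec.snd) primrec_moveSuccessors

end CodedConfig

/-! ### Simulation between configurations and their codes. -/

/-- The number of a word type in the coding of instructions. -/
def WordType.num : WordType → ℕ
  | hasNext => 0
  | isLast => 1

theorem WordType.num_injective : Function.Injective WordType.num := by
  rintro (_ | _) (_ | _) h <;> simp_all [WordType.num]

theorem WordType.num_eq (α : WordType) : α.num = 0 ∨ α.num = 1 := by
  cases α <;> simp [WordType.num]

theorem WordType.exists_num_eq {m : ℕ} (h : m = 0 ∨ m = 1) : ∃ α : WordType, m = α.num := by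
  obtain rfl | rfl := h
  · exact ⟨.hasNext, rfl⟩
  · exact ⟨.isLast, rfl⟩

variable {A : Type v} {Q : Type w} {D : Type u} {k n : ℕ}

/-- The pair of numbers `s` stands for the thread `t`, where `g` decodes data values. -/
def CodesThread (eQ : Q ≃ Fin n) (g : ℕ → D) (s : ℕ × ℕ) (t : Q × D) : Prop :=
  s.1 = eQ t.1 ∧ g s.2 = t.2

theorem CodesThread.right_unique {eQ : Q ≃ Fin n} {g : ℕ → D} {s : ℕ × ℕ} {t t' : Q × D}
    (h : CodesThread eQ g s t) (h' : CodesThread eQ g s t') : t = t' :=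
  Prod.ext (eQ.injective (Fin.ext (h.1.symm.trans h'.1))) (h.2.symm.trans h'.2)

theorem CodesThread.left_unique {eQ : Q ≃ Fin n} {g : ℕ → D} {s s' : ℕ × ℕ} {t : Q × D} {S : Set ℕ}
    (hg : S.InjOn g) (hs : s.2 ∈ S) (hs' : s'.2 ∈ S) (h : CodesThread eQ g s t)
    (h' : CodesThread eQ g s' t) : s = s' :=
  Prod.ext (h.1.trans h'.1.symm) (hg hs hs' (h.2.trans h'.2.symm))

theorem Instr.isMoving_iff_code (eA : A ≃ Fin k) (eQ : Q ≃ Fin n) {φ : Instr A Q} :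
    φ.IsMoving ↔ (φ.code eA eQ).1 = 8 := by
  rcases φ with _ | _ | ⟨_ | _⟩ | _ | _ | _ | _ | _ | _ | _ | _ <;>
    simp [Instr.IsMoving, Instr.code]

theorem Instr.isSpread_iff_code (eA : A ≃ Fin k) (eQ : Q ≃ Fin n) {φ : Instr A Q} :
    φ.IsSpread ↔ (φ.code eA eQ).1 = 10 := by
  rcases φ with _ | _ | ⟨_ | _⟩ | _ | _ | _ | _ | _ | _ | _ | _ <;>
    simp [Instr.IsSpread, Instr.code]

namespace CodedConfig

theorem instr_code (M : ARA A Q) (eA : A ≃ Fin k) (eQ : Q ≃ Fin n) (q : Q) :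
    instr (M.code eA eQ).2.2 (eQ q) = (M.δ q).code eA eQ := by
  simp [instr, ARA.code, List.getD_eq_getElem?_getD]

theorem instr_of_codesThread (M : ARA A Q) (eA : A ≃ Fin k) {eQ : Q ≃ Fin n} {g : ℕ → D}
    {s : ℕ × ℕ} {t : Q × D} (h : CodesThread eQ g s t) :
    instr (M.code eA eQ).2.2 s.1 = (M.δ t.1).code eA eQ := by
  rw [h.1, instr_code]

theorem datum_mem_data (c : CodedConfig) : c.datum ∈ c.data := Or.inl rfl

theorem mem_data_of_mem_threads {c : CodedConfig} {s : ℕ × ℕ} (hs : s ∈ c.threads) :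
    s.2 ∈ c.data := Or.inr ⟨s, hs, rfl⟩

/-- The coded configuration `c` stands for a part of the configuration `C`, where `g` decodes
data values. -/
structure CodesPart (eA : A ≃ Fin k) (eQ : Q ≃ Fin n) (g : ℕ → D) (c : CodedConfig)
    (C : Config A Q D) : Prop where
  type_eq : c.type = C.type.num
  letter_eq : c.letter = eA C.label.1
  datum_eq : g c.datum = C.label.2
  exists_thread : ∀ s ∈ c.threads, ∃ t ∈ C.threads, CodesThread eQ g s t
  injOn : c.data.InjOn g

/-- The coded configuration `c` stands for the configuration `C`. -/
structure Codes (eA : A ≃ Fin k) (eQ : Q ≃ Fin n) (g : ℕ → D) (c : CodedConfig)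
    (C : Config A Q D) : Prop extends CodesPart eA eQ g c C where
  exists_code : ∀ t ∈ C.threads, ∃ s ∈ c.threads, CodesThread eQ g s t

theorem CodesPart.of_incl {eA : A ≃ Fin k} {eQ : Q ≃ Fin n} {g : ℕ → D} {c c' : CodedConfig}
    {C : Config A Q D} (h : c.CodesPart eA eQ g C) (hc : c'.Incl c) : c'.CodesPart eA eQ g C where
  type_eq := hc.1.trans h.type_eq
  letter_eq := hc.2.1.trans h.letter_eq
  datum_eq := by rw [hc.2.2.1, h.datum_eq]
  exists_thread s hs := h.exists_thread s (hc.2.2.2 s hs)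
  injOn := h.injOn.mono (by
    rintro e (rfl | ⟨s, hs, rfl⟩)
    · rw [hc.2.2.1]
      exact c.datum_mem_data
    · exact mem_data_of_mem_threads (hc.2.2.2 s hs))

variable [DecidableEq Q] [DecidableEq D]

/-- The value `e` is fixed by the transition before `c`, `g` and `v` are given, so that the decoding
`g` can later be adjusted to send a fresh number to `e`. Only `guess` uses it; elsewhere `t.2` is a
placeholder. -/
theorem CodesPart.exists_replacement {M : ARA A Q} {C : Config A Q D} {t : Q × D}
    {X : Finset (Q × D)} (hX : M.Effect C.type C.label C.threads t X) (eA : A ≃ Fin k)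
    (eQ : Q ≃ Fin n) :
    ∃ e : D, ∀ {c : CodedConfig} {g : ℕ → D} {V : List ℕ} {s : ℕ × ℕ} {v : ℕ},
      c.CodesPart eA eQ g C → s ∈ c.threads → CodesThread eQ g s t → v ∈ V → g v = e →
      ∃ Y ∈ replacements (M.code eA eQ).2.2 V c s,
        ∀ y ∈ Y, y.2 ∈ insert v c.data ∧ ∃ x ∈ X, CodesThread eQ g y x := by
  unfold ARA.Effect at hX
  split at hX
  case h_1 b hδ =>
    refine ⟨t.2, fun {c g V s v} hc hs hst hv hgv => ⟨[], ?_, by simp⟩⟩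
    have : c.TestSucceeds (instr (M.code eA eQ).2.2 s.1) s.2 := by
      simp [TestSucceeds, instr_of_codesThread M eA hst, hδ, Instr.code, hX.1, hc.letter_eq]
    simp [replacements, this]
  case h_2 b hδ =>
    refine ⟨t.2, fun {c g V s v} hc hs hst hv hgv => ⟨[], ?_, by simp⟩⟩
    have : c.TestSucceeds (instr (M.code eA eQ).2.2 s.1) s.2 := by
      simp [TestSucceeds, instr_of_codesThread M eA hst, hδ, Instr.code, hX.1, hc.letter_eq,
        Fin.val_inj]
    simp [replacements, this]
  case h_3 β hδ =>
    refine ⟨t.2, fun {c g V s v} hc hs hst hv hgv => ⟨[], ?_, by simp⟩⟩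
    have : c.TestSucceeds (instr (M.code eA eQ).2.2 s.1) s.2 := by
      have := hc.type_eq
      rw [← hX.1] at this
      cases β <;>
        simp [TestSucceeds, instr_of_codesThread M eA hst, hδ, Instr.code, this, WordType.num]
    simp [replacements, this]
  case h_4 q hδ =>
    refine ⟨t.2, fun {c g V s v} hc hs hst hv hgv => ⟨[(eQ q, c.datum)], ?_, ?_⟩⟩
    · simp [replacements, TestSucceeds, instr_of_codesThread M eA hst, hδ, Instr.code]
    · simp [CodesThread, hX, hc.datum_eq, datum_mem_data]
  case h_5 hδ =>
    refine ⟨t.2, fun {c g V s v} hc hs hst hv hgv => ⟨[], ?_, by simp⟩⟩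
    have : c.datum = s.2 := hc.injOn c.datum_mem_data (mem_data_of_mem_threads hs)
      (by rw [hc.datum_eq, hX.1, hst.2])
    simp [replacements, TestSucceeds, instr_of_codesThread M eA hst, hδ, Instr.code, this]
  case h_6 hδ =>
    refine ⟨t.2, fun {c g V s v} hc hs hst hv hgv => ⟨[], ?_, by simp⟩⟩
    have : c.datum ≠ s.2 := fun h => hX.1 (by rw [← hc.datum_eq, h, hst.2])
    simp [replacements, TestSucceeds, instr_of_codesThread M eA hst, hδ, Instr.code, this]
  case h_7 q₁ q₂ hδ =>
    refine ⟨t.2, fun {c g V s v} hc hs hst hv hgv => ⟨[(eQ q₁, s.2), (eQ q₂, s.2)], ?_, ?_⟩⟩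
    · simp [replacements, TestSucceeds, instr_of_codesThread M eA hst, hδ, Instr.code]
    · simp [CodesThread, hX, hst.2, mem_data_of_mem_threads hs]
  case h_8 q₁ q₂ hδ =>
    obtain rfl | rfl := hX
    · refine ⟨t.2, fun {c g V s v} hc hs hst hv hgv => ⟨[(eQ q₁, s.2)], ?_, ?_⟩⟩
      · simp [replacements, TestSucceeds, instr_of_codesThread M eA hst, hδ, Instr.code]
      · simp [CodesThread, hst.2, mem_data_of_mem_threads hs]
    · refine ⟨t.2, fun {c g V s v} hc hs hst hv hgv => ⟨[(eQ q₂, s.2)], ?_, ?_⟩⟩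
      · simp [replacements, TestSucceeds, instr_of_codesThread M eA hst, hδ, Instr.code]
      · simp [CodesThread, hst.2, mem_data_of_mem_threads hs]
  case h_9 => exact hX.elim
  case h_10 q hδ =>
    obtain ⟨e, rfl⟩ := hX
    refine ⟨e, fun {c g V s v} hc hs hst hv hgv => ⟨[(eQ q, v)], ?_, ?_⟩⟩
    · simp [replacements, TestSucceeds, instr_of_codesThread M eA hst, hδ, Instr.code, hv]
    · simp [CodesThread, hgv]
  case h_11 q₂ q₁ hδ =>
    obtain ⟨hX, rfl⟩ := hX
    refine ⟨t.2, fun {c g V s v} hc hs hst hv hgv => ?_⟩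
    -- Injectivity of `g` on the values of `c` makes the removal of `s` from the code agree with the
    -- removal of `t` from the configuration.
    have hne : ∀ {s' t'}, s' ∈ c.threads → s' ≠ s → CodesThread eQ g s' t' → t' ≠ t := by
      rintro s' t' hs' hne h rfl
      exact hne (h.left_unique hc.injOn (mem_data_of_mem_threads hs')
        (mem_data_of_mem_threads hs) hst)
    have hcond : ∀ s' ∈ c.threads, s' = s ∨ (instr (M.code eA eQ).2.2 s'.1).1 = 10 ∨
        (instr (M.code eA eQ).2.2 s'.1).1 = 8 := by
      intro s' hs'
      obtain ⟨t', ht', hst'⟩ := hc.exists_thread s' hs'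
      by_cases h : s' = s
      · exact .inl h
      · rw [instr_of_codesThread M eA hst', ← Instr.isMoving_iff_code, ← Instr.isSpread_iff_code]
        exact .inr (hX t' (Finset.mem_erase.2 ⟨hne hs' h hst', ht'⟩))
    refine ⟨(c.threads.filter fun s' => s' ≠ s ∧ s'.1 = eQ q₂).map fun s' => (↑(eQ q₁), s'.2),
      ?_, ?_⟩
    · rw [replacements, if_neg, if_neg, if_neg, if_neg, if_neg, if_pos] <;>
        simp [instr_of_codesThread M eA hst, TestSucceeds, hδ, Instr.code]
      simpa using hcond
    · intro y hy
      simp only [List.mem_map, List.mem_filter, decide_eq_true_eq] at hy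
      obtain ⟨s', ⟨hs', hs's, hq⟩, rfl⟩ := hy
      obtain ⟨t', ht', hst'⟩ := hc.exists_thread s' hs'
      refine ⟨.inr (.inr ⟨s', hs', rfl⟩), (q₁, t'.2), ?_, rfl, hst'.2⟩
      refine Finset.mem_image.2 ⟨t', Finset.mem_filter.2
        ⟨Finset.mem_erase.2 ⟨hne hs' hs's hst', ht'⟩, ?_⟩, rfl⟩
      exact eQ.injective (Fin.ext (hst'.1.symm.trans hq))

/-- Here all threads of `C` must be coded: the condition of `spread` concerns every other thread of
`C`, and a partial code could allow a `spread` that `C` does not. -/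
theorem Codes.exists_effect {M : ARA A Q} {C : Config A Q D} {t : Q × D} {eA : A ≃ Fin k}
    {eQ : Q ≃ Fin n} {c : CodedConfig} {g : ℕ → D} {V : List ℕ} {s : ℕ × ℕ} {Y : List (ℕ × ℕ)}
    (hc : c.Codes eA eQ g C) (hs : s ∈ c.threads) (hst : CodesThread eQ g s t)
    (hY : Y ∈ replacements (M.code eA eQ).2.2 V c s) :
    ∃ X, M.Effect C.type C.label C.threads t X ∧ (∀ y ∈ Y, ∃ x ∈ X, CodesThread eQ g y x) ∧
      ∀ x ∈ X, ∃ y ∈ Y, CodesThread eQ g y x := by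
  cases hδ : M.δ t.1 with
  | letter b =>
    simp [replacements, instr_of_codesThread M eA hst, hδ, Instr.code] at hY
    have : b = C.label.1 := by simpa [TestSucceeds, hc.letter_eq, Fin.val_inj] using hY.1
    exact ⟨∅, by simp [ARA.Effect, hδ, this], by simp [hY.2]⟩
  | notLetter b =>
    simp [replacements, instr_of_codesThread M eA hst, hδ, Instr.code] at hY
    have : b ≠ C.label.1 := by simpa [TestSucceeds, hc.letter_eq, Fin.val_inj] using hY.1
    exact ⟨∅, by simp [ARA.Effect, hδ, this], by simp [hY.2]⟩
  | test β =>
    have : Y = [] ∧ β.num = C.type.num := by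
      rw [← hc.type_eq]
      cases β <;>
        simp [replacements, TestSucceeds, instr_of_codesThread M eA hst, hδ, Instr.code] at hY <;>
        exact ⟨hY.2, hY.1⟩
    exact ⟨∅, by simp [ARA.Effect, hδ, WordType.num_injective this.2], by simp [this.1]⟩
  | store q =>
    simp [replacements, TestSucceeds, instr_of_codesThread M eA hst, hδ, Instr.code] at hY
    exact ⟨{(q, C.label.2)}, by simp [ARA.Effect, hδ], by simp [hY, CodesThread, hc.datum_eq]⟩
  | eq =>
    simp [replacements, TestSucceeds, instr_of_codesThread M eA hst, hδ, Instr.code] at hY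
    exact ⟨∅, by simp [ARA.Effect, hδ, ← hc.datum_eq, ← hst.2, hY.1], by simp [hY.2]⟩
  | neq =>
    simp [replacements, TestSucceeds, instr_of_codesThread M eA hst, hδ, Instr.code] at hY
    have : C.label.2 ≠ t.2 := by
      rw [← hc.datum_eq, ← hst.2]
      exact fun h => hY.1 (hc.injOn c.datum_mem_data (mem_data_of_mem_threads hs) h)
    exact ⟨∅, by simp [ARA.Effect, hδ, this], by simp [hY.2]⟩
  | and q₁ q₂ =>
    simp [replacements, TestSucceeds, instr_of_codesThread M eA hst, hδ, Instr.code] at hY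
    exact ⟨{(q₁, t.2), (q₂, t.2)}, by simp [ARA.Effect, hδ], by simp [hY, CodesThread, hst.2]⟩
  | or q₁ q₂ =>
    simp [replacements, TestSucceeds, instr_of_codesThread M eA hst, hδ, Instr.code] at hY
    obtain rfl | rfl := hY
    · exact ⟨{(q₁, t.2)}, by simp [ARA.Effect, hδ], by simp [CodesThread, hst.2]⟩
    · exact ⟨{(q₂, t.2)}, by simp [ARA.Effect, hδ], by simp [CodesThread, hst.2]⟩
  | move q =>
    simp [replacements, TestSucceeds, instr_of_codesThread M eA hst, hδ, Instr.code] at hY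
  | guess q =>
    simp [replacements, TestSucceeds, instr_of_codesThread M eA hst, hδ, Instr.code] at hY
    obtain ⟨v, hv, rfl⟩ := hY
    exact ⟨{(q, g v)}, by simp [ARA.Effect, hδ], by simp [CodesThread]⟩
  | spread q₂ q₁ =>
    rw [replacements,
      if_neg (by simp [instr_of_codesThread M eA hst, TestSucceeds, hδ, Instr.code]),
      if_neg (by simp [instr_of_codesThread M eA hst, hδ, Instr.code]),
      if_neg (by simp [instr_of_codesThread M eA hst, hδ, Instr.code]),
      if_neg (by simp [instr_of_codesThread M eA hst, hδ, Instr.code]),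
      if_neg (by simp [instr_of_codesThread M eA hst, hδ, Instr.code])] at hY
    split_ifs at hY with h
    swap
    · simp at hY
    obtain rfl := List.mem_singleton.1 hY
    rw [instr_of_codesThread M eA hst, hδ]
    have hmem : ∀ {s' t'}, t' ∈ C.threads.erase t → s' ∈ c.threads → CodesThread eQ g s' t' →
        s' ≠ s := by
      rintro s' t' ht' hs' hst' rfl
      exact (Finset.mem_erase.1 ht').1 (hst'.right_unique hst)
    refine ⟨((C.threads.erase t).filter fun t' => t'.1 = q₂).image fun t' => (q₁, t'.2),
      ?_, ?_, ?_⟩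
    · simp only [ARA.Effect, hδ, and_true]
      intro t' ht'
      obtain ⟨s', hs', hst'⟩ := hc.exists_code t' (Finset.mem_of_mem_erase ht')
      have := (h.2 s' hs').resolve_left (hmem ht' hs' hst')
      rwa [instr_of_codesThread M eA hst', ← Instr.isMoving_iff_code,
        ← Instr.isSpread_iff_code] at this
    · intro y hy
      obtain ⟨s', hs', rfl⟩ := List.mem_map.1 hy
      obtain ⟨hs', hcond⟩ := List.mem_filter.1 hs'
      obtain ⟨hs's, hq⟩ := of_decide_eq_true hcond
      obtain ⟨t', ht', hst'⟩ := hc.exists_thread s' hs'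
      refine ⟨(q₁, t'.2), Finset.mem_image.2 ⟨t', Finset.mem_filter.2
        ⟨Finset.mem_erase.2 ⟨?_, ht'⟩, ?_⟩, rfl⟩, rfl, hst'.2⟩
      · rintro rfl
        exact hs's (hst'.left_unique hc.injOn (mem_data_of_mem_threads hs')
          (mem_data_of_mem_threads hs) hst)
      · exact eQ.injective (Fin.ext (hst'.1.symm.trans hq))
    · intro x hx
      simp only [Finset.mem_image, Finset.mem_filter] at hx
      obtain ⟨t', ⟨ht', rfl⟩, rfl⟩ := hx
      obtain ⟨s', hs', hst'⟩ := hc.exists_code t' (Finset.mem_of_mem_erase ht')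
      refine ⟨(eQ q₁, s'.2), List.mem_map.2 ⟨s', List.mem_filter.2 ⟨hs', ?_⟩, rfl⟩, rfl, hst'.2⟩
      exact decide_eq_true ⟨hmem ht' hs' hst', hst'.1⟩

end CodedConfig

namespace CodedConfig

theorem snd_mem_of_mem_replacements {T : List (ℕ × ℕ × ℕ)} {V : List ℕ} {c : CodedConfig}
    {t : ℕ × ℕ} {X : List (ℕ × ℕ)} (hV : ∀ e ∈ c.data, e ∈ V) (ht : t ∈ c.threads)
    (hX : X ∈ replacements T V c t) {x : ℕ × ℕ} (hx : x ∈ X) : x.2 ∈ V := by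
  have hd := hV _ c.datum_mem_data
  have he := hV _ (mem_data_of_mem_threads ht)
  unfold replacements at hX
  split_ifs at hX
  · simp_all
  · simp_all
  · obtain rfl := List.mem_singleton.1 hX
    obtain rfl | hx := List.mem_cons.1 hx
    · exact he
    · obtain rfl := List.mem_singleton.1 hx
      exact he
  · obtain rfl | hX := List.mem_cons.1 hX
    · obtain rfl := List.mem_singleton.1 hx
      exact he
    · obtain rfl := List.mem_singleton.1 hX
      obtain rfl := List.mem_singleton.1 hx
      exact he
  · obtain ⟨v, hv, rfl⟩ := List.mem_map.1 hX
    obtain rfl := List.mem_singleton.1 hx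
    exact hv
  · obtain rfl := List.mem_singleton.1 hX
    obtain ⟨s, hs, rfl⟩ := List.mem_map.1 hx
    exact hV s.2 (mem_data_of_mem_threads (s := s) (List.mem_filter.1 hs).1)
  · simp at hX

theorem mem_epsSuccessors {T : List (ℕ × ℕ × ℕ)} {V : List ℕ} {c c' : CodedConfig} :
    c' ∈ epsSuccessors T V c ↔ ∃ t ∈ c.threads, ∃ X ∈ replacements T V c t,
      (c.type, c.letter, c.datum, X ++ c.threads.filter fun s => s ≠ t) = c' := by
  simp only [epsSuccessors, List.mem_flatMap, List.mem_map]

theorem mem_moveSuccessors {T : List (ℕ × ℕ × ℕ)} {V : List ℕ} {c c' : CodedConfig} :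
    c' ∈ moveSuccessors k T V c ↔ (c.type = 0 ∧ ∀ s ∈ c.threads, (instr T s.1).1 = 8) ∧
      (c'.type = 0 ∨ c'.type = 1) ∧ c'.letter < k ∧ c'.datum ∈ V ∧
        c'.threads = c.threads.map fun s => ((instr T s.1).2.1, s.2) := by
  unfold moveSuccessors
  split_ifs with h
  · rw [mem_withLabels, and_iff_right h]
  · simp only [List.not_mem_nil, h, false_and]

theorem data_subset_of_mem_successors {T : List (ℕ × ℕ × ℕ)} {V : List ℕ} {c c' : CodedConfig}
    (hV : ∀ e ∈ c.data, e ∈ V) (hc' : c' ∈ successors k T V c) : ∀ e ∈ c'.data, e ∈ V := by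
  obtain hc' | hc' := List.mem_append.1 hc'
  · obtain ⟨t, ht, X, hX, rfl⟩ := mem_epsSuccessors.1 hc'
    rintro e (rfl | ⟨s, hs, rfl⟩)
    · exact hV _ c.datum_mem_data
    · obtain hs | hs := List.mem_append.1 hs
      · exact snd_mem_of_mem_replacements hV ht hX hs
      · exact hV _ (mem_data_of_mem_threads (List.mem_filter.1 hs).1)
  · obtain ⟨-, -, -, hd, hΔ⟩ := mem_moveSuccessors.1 hc'
    rintro e (rfl | ⟨s, hs, rfl⟩)
    · exact hd
    · rw [hΔ] at hs
      obtain ⟨s', hs', rfl⟩ := List.mem_map.1 hs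
      exact hV s'.2 (mem_data_of_mem_threads (s := s') hs')

theorem CodesPart.exists_successor_of_stepMove {M : ARA A Q} {C C' : Config A Q D}
    (h : M.StepMove C C') {eA : A ≃ Fin k} {eQ : Q ≃ Fin n} {c : CodedConfig} {g : ℕ → D}
    {V : List ℕ} {v : ℕ} (hc : c.CodesPart eA eQ g C) (hv : v ∈ V) (hgv : g v = C'.label.2)
    (hg : (insert v c.data).InjOn g) :
    ∃ c' ∈ successors k (M.code eA eQ).2.2 V c, c'.CodesPart eA eQ g C' := by
  cases h with
  | @mk i γ Δ α' γ' Δ' hmov hΔ =>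
    refine ⟨(α'.num, eA γ'.1, v,
      c.threads.map fun s => ((instr (M.code eA eQ).2.2 s.1).2.1, s.2)),
      List.mem_append_right _ (mem_moveSuccessors.2 ⟨⟨hc.type_eq, fun s hs => ?_⟩, α'.num_eq,
        (eA γ'.1).2, hv, rfl⟩), rfl, rfl, hgv, ?_, hg.mono ?_⟩
    · obtain ⟨t, ht, hst⟩ := hc.exists_thread s hs
      rw [instr_of_codesThread M eA hst, ← Instr.isMoving_iff_code]
      exact hmov t ht
    · intro y hy
      obtain ⟨s, hs, rfl⟩ := List.mem_map.1 hy
      obtain ⟨t, ht, hst⟩ := hc.exists_thread s hs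
      obtain ⟨q, hq⟩ := hmov t ht
      refine ⟨(q, t.2), (hΔ _).2 ⟨t.1, ht, hq⟩, ?_, hst.2⟩
      simp [instr_of_codesThread M eA hst, hq, Instr.code]
    · rintro x (rfl | ⟨y, hy, rfl⟩)
      · exact .inl rfl
      · obtain ⟨s, hs, rfl⟩ := List.mem_map.1 hy
        exact .inr (mem_data_of_mem_threads (s := s) hs)

variable [DecidableEq Q] [DecidableEq D]

/-- The same dichotomy as for compatibility: the code fires the thread if it contains a code of it,
and stays unchanged otherwise. As before, `e` is chosen ahead of the decoding. -/
theorem CodesPart.exists_successor_of_stepEps {M : ARA A Q} {C C' : Config A Q D}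
    (h : M.StepEps C C') (eA : A ≃ Fin k) (eQ : Q ≃ Fin n) :
    ∃ e : D, ∀ {c : CodedConfig} {g : ℕ → D} {V : List ℕ} {v : ℕ}, c.CodesPart eA eQ g C →
      v ∈ V → g v = e → (insert v c.data).InjOn g →
      ∃ c', (c' = c ∨ c' ∈ successors k (M.code eA eQ).2.2 V c) ∧ c'.CodesPart eA eQ g C' := by
  obtain ⟨-, htype, hlabel, t, -, X, hX, hsub⟩ := h.exists_effect
  obtain ⟨e, he⟩ := CodesPart.exists_replacement hX eA eQ
  refine ⟨e, fun {c g V v} hc hv hgv hg => ?_⟩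
  by_cases hs : ∃ s ∈ c.threads, CodesThread eQ g s t
  · obtain ⟨s, hs, hst⟩ := hs
    obtain ⟨Y, hY, hYX⟩ := he hc hs hst hv hgv
    refine ⟨_, .inr (List.mem_append_left _ (mem_epsSuccessors.2 ⟨s, hs, Y, hY, rfl⟩)), ?_⟩
    refine ⟨by rw [htype, ← hc.type_eq], by rw [hlabel, ← hc.letter_eq],
      by rw [hlabel, ← hc.datum_eq], ?_, hg.mono ?_⟩
    · intro y hy
      obtain hy | hy := List.mem_append.1 hy
      · obtain ⟨-, x, hx, hyx⟩ := hYX y hy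
        exact ⟨x, hsub (Finset.mem_union_left _ hx), hyx⟩
      · simp only [List.mem_filter, decide_eq_true_eq] at hy
        obtain ⟨t', ht', hyt'⟩ := hc.exists_thread y hy.1
        refine ⟨t', hsub (Finset.mem_union_right _ (Finset.mem_erase.2 ⟨?_, ht'⟩)), hyt'⟩
        rintro rfl
        exact hy.2 (hyt'.left_unique hc.injOn (mem_data_of_mem_threads hy.1)
          (mem_data_of_mem_threads hs) hst)
    · rintro x (rfl | ⟨y, hy, rfl⟩)
      · exact .inr c.datum_mem_data
      · obtain hy | hy := List.mem_append.1 hy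
        · exact (hYX y hy).1
        · exact .inr (mem_data_of_mem_threads (List.mem_filter.1 hy).1)
  · refine ⟨c, .inl rfl, by rw [htype, ← hc.type_eq], by rw [hlabel, ← hc.letter_eq],
      by rw [hlabel, ← hc.datum_eq], fun s hs' => ?_, hc.injOn⟩
    obtain ⟨t', ht', hst'⟩ := hc.exists_thread s hs'
    refine ⟨t', hsub (Finset.mem_union_right _ (Finset.mem_erase.2 ⟨?_, ht'⟩)), hst'⟩
    rintro rfl
    exact hs ⟨s, hs', hst'⟩

/-- Every transition of `C` is matched from a coded part of `C`, provided that `V` contains the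
values of that part and a fresh value. -/
theorem CodesPart.exists_successor {M : ARA A Q} {C C' : Config A Q D} (h : M.Step C C')
    {eA : A ≃ Fin k} {eQ : Q ≃ Fin n} {c : CodedConfig} {g : ℕ → D} {V : List ℕ}
    (hc : c.CodesPart eA eQ g C) (hV : ∀ e ∈ c.data, e ∈ V) (hfresh : ∃ v ∈ V, v ∉ c.data) :
    ∃ c', (c' = c ∨ c' ∈ successors k (M.code eA eQ).2.2 V c) ∧
      ∃ g' : ℕ → D, c'.CodesPart eA eQ g' C' := by
  -- A transition brings in at most one value: the datum of the next position or the guessed value.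
  obtain ⟨e, he⟩ : ∃ e : D, ∀ {g : ℕ → D} {v : ℕ}, c.CodesPart eA eQ g C →
      v ∈ V → g v = e → (insert v c.data).InjOn g →
      ∃ c', (c' = c ∨ c' ∈ successors k (M.code eA eQ).2.2 V c) ∧ c'.CodesPart eA eQ g C' := by
    obtain h | h := h
    · refine ⟨C'.label.2, fun hc hv hgv hg => ?_⟩
      obtain ⟨c', hc', h'⟩ := hc.exists_successor_of_stepMove h hv hgv hg
      exact ⟨c', .inr hc', h'⟩
    · obtain ⟨e, he⟩ := CodesPart.exists_successor_of_stepEps h eA eQ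
      exact ⟨e, he⟩
  -- If `e` is already the value of a number in `c`, that number must be reused to keep `g`
  -- injective. Otherwise the fresh number is redirected to `e`, which leaves the decoding of `c`
  -- unchanged.
  by_cases hmem : ∃ v ∈ c.data, g v = e
  · obtain ⟨v, hv, hgv⟩ := hmem
    obtain ⟨c', hc', h'⟩ := he hc (hV v hv) hgv (by rw [Set.insert_eq_of_mem hv]; exact hc.injOn)
    exact ⟨c', hc', g, h'⟩
  · obtain ⟨v, hv, hvc⟩ := hfresh
    have heq : ∀ x ∈ c.data, Function.update g v e x = g x := fun x hx =>
      Function.update_of_ne (ne_of_mem_of_not_mem hx hvc) _ _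
    have hinj : c.data.InjOn (Function.update g v e) := hc.injOn.congr fun x hx => (heq x hx).symm
    have hc₁ : c.CodesPart eA eQ (Function.update g v e) C :=
      ⟨hc.type_eq, hc.letter_eq, by rw [heq _ c.datum_mem_data, hc.datum_eq], fun s hs => by
        obtain ⟨t, ht, hst⟩ := hc.exists_thread s hs
        exact ⟨t, ht, hst.1, by rw [heq _ (mem_data_of_mem_threads hs), hst.2]⟩, hinj⟩
    obtain ⟨c', hc', hcodes⟩ := he hc₁ hv (Function.update_self v e g)
      ((Set.injOn_insert hvc).2 ⟨hinj, by
        rintro ⟨x, hx, h⟩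
        rw [heq x hx, Function.update_self] at h
        exact hmem ⟨x, hx, h⟩⟩)
    exact ⟨c', hc', _, hcodes⟩

/-- Every successor of a code of `C` codes a successor of `C`. -/
theorem Codes.exists_step {M : ARA A Q} {C : Config A Q D} {eA : A ≃ Fin k} {eQ : Q ≃ Fin n}
    {c c' : CodedConfig} {g : ℕ → D} {V : List ℕ} (hg : Function.Injective g)
    (hc : c.Codes eA eQ g C) (hc' : c' ∈ successors k (M.code eA eQ).2.2 V c) :
    ∃ C', M.Step C C' ∧ c'.Codes eA eQ g C' := by
  obtain hc' | hc' := List.mem_append.1 hc'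
  · obtain ⟨s, hs, Y, hY, rfl⟩ := mem_epsSuccessors.1 hc'
    obtain ⟨t, ht, hst⟩ := hc.exists_thread s hs
    obtain ⟨X, hX, hYX, hXY⟩ := hc.exists_effect hs hst hY
    refine ⟨_, .inr (hX.stepEps ht), ⟨hc.type_eq, hc.letter_eq, hc.datum_eq, ?_, hg.injOn⟩, ?_⟩
    · intro y hy
      obtain hy | hy := List.mem_append.1 hy
      · obtain ⟨x, hx, hyx⟩ := hYX y hy
        exact ⟨x, Finset.mem_union_left _ hx, hyx⟩
      · simp only [List.mem_filter, decide_eq_true_eq] at hy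
        obtain ⟨t', ht', hyt'⟩ := hc.exists_thread y hy.1
        refine ⟨t', Finset.mem_union_right _ (Finset.mem_erase.2 ⟨?_, ht'⟩), hyt'⟩
        rintro rfl
        exact hy.2 (hyt'.left_unique hg.injOn (Set.mem_univ _) (Set.mem_univ _) hst)
    · intro x hx
      obtain hx | hx := Finset.mem_union.1 hx
      · obtain ⟨y, hy, hyx⟩ := hXY x hx
        exact ⟨y, List.mem_append_left _ hy, hyx⟩
      · obtain ⟨hxt, hx⟩ := Finset.mem_erase.1 hx
        obtain ⟨s', hs', hs'x⟩ := hc.exists_code x hx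
        refine ⟨s', List.mem_append_right _ (List.mem_filter.2 ⟨hs', ?_⟩), hs'x⟩
        rw [decide_eq_true_eq]
        rintro rfl
        exact hxt (hs'x.right_unique hst)
  · obtain ⟨⟨hα, hmov⟩, hα', ha', -, hΔ⟩ := mem_moveSuccessors.1 hc'
    obtain ⟨α', hα'⟩ := WordType.exists_num_eq hα'
    obtain ⟨i, α, γ, Δ⟩ := C
    obtain rfl : α = .hasNext := WordType.num_injective (hc.type_eq.symm.trans hα)
    have hmov' : ∀ t ∈ Δ, (M.δ t.1).IsMoving := fun t ht => by
      obtain ⟨s, hs, hst⟩ := hc.exists_code t ht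
      rw [Instr.isMoving_iff_code eA eQ, ← instr_of_codesThread M eA hst]
      exact hmov s hs
    refine ⟨⟨i + 1, α', (eA.symm ⟨c'.letter, ha'⟩, g c'.datum), M.movedThreads Δ⟩,
      .inl (.mk hmov' fun t => ARA.mem_movedThreads), ⟨hα', by simp, rfl, ?_, hg.injOn⟩, ?_⟩
    · rw [hΔ]
      intro y hy
      obtain ⟨s, hs, rfl⟩ := List.mem_map.1 hy
      obtain ⟨t, ht, hst⟩ := hc.exists_thread s hs
      obtain ⟨q, hq⟩ := hmov' t ht
      refine ⟨(q, t.2), ARA.mem_movedThreads.2 ⟨t.1, ht, hq⟩, ?_, hst.2⟩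
      simp [instr_of_codesThread M eA hst, hq, Instr.code]
    · rw [hΔ]
      intro t ht
      obtain ⟨q, hq, hqt⟩ := ARA.mem_movedThreads.1 ht
      obtain ⟨s, hs, hst⟩ := hc.exists_code _ hq
      refine ⟨_, List.mem_map.2 ⟨s, hs, rfl⟩, ?_, hst.2⟩
      simp [instr_of_codesThread M eA hst, hqt, Instr.code]

end CodedConfig

/-! ### Certificates of emptiness and bounded exploration. -/

namespace CodedConfig

/-- The coded initial configurations, with datum `0`. -/
def initials (k s : ℕ) : List CodedConfig := withLabels k [0] [(s, 0)]

/-- The pair `(V, B)` witnesses that no accepting configuration is reachable: every initial coded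
configuration and every successor of a member of `B` includes a member of `B`, no member of `B` is
accepting, and each leaves a value in `V` unused. -/
def EmptinessCert (a : ℕ × ℕ × List (ℕ × ℕ × ℕ)) (x : List ℕ × List CodedConfig) : Prop :=
  (∀ c ∈ initials a.1 a.2.1, ∃ b ∈ x.2, b.Incl c) ∧
    ∀ b ∈ x.2, b.threads ≠ [] ∧ b.datum ∈ x.1 ∧ (∀ t ∈ b.threads, t.2 ∈ x.1) ∧
      (∃ v ∈ x.1, v ≠ b.datum ∧ ∀ t ∈ b.threads, t.2 ≠ v) ∧
      ∀ c ∈ successors a.1 a.2.2 x.1 b, ∃ b' ∈ x.2, b'.Incl c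

/-- The coded configurations that are reachable by `m` transitions, where each transition may use
one more data value than the previous one. -/
def reached (a : ℕ × ℕ × List (ℕ × ℕ × ℕ)) : ℕ → List CodedConfig
  | 0 => initials a.1 a.2.1
  | m + 1 => reached a m ++ (reached a m).flatMap (successors a.1 a.2.2 (List.range (m + 2)))

theorem primrec_initials : Primrec fun x : ℕ × ℕ => initials x.1 x.2 :=
  primrec_withLabels.comp (Primrec.fst.pair ((Primrec.const [0]).pair
    (Primrec.list_cons.comp (Primrec.snd.pair (Primrec.const 0)) (Primrec.const []))))

theorem primrecPred_emptinessCert :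
    PrimrecPred fun x : (ℕ × ℕ × List (ℕ × ℕ × ℕ)) × List ℕ × List CodedConfig =>
      EmptinessCert x.1 x.2 := by
  have hB : Primrec fun x : (ℕ × ℕ × List (ℕ × ℕ × ℕ)) × List ℕ × List CodedConfig => x.2.2 :=
    Primrec.snd.comp Primrec.snd
  have hV : Primrec fun x : (ℕ × ℕ × List (ℕ × ℕ × ℕ)) × List ℕ × List CodedConfig => x.2.1 :=
    Primrec.fst.comp Primrec.snd
  have hk : Primrec fun x : (ℕ × ℕ × List (ℕ × ℕ × ℕ)) × List ℕ × List CodedConfig => x.1.1 :=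
    Primrec.fst.comp Primrec.fst
  have hs : Primrec fun x : (ℕ × ℕ × List (ℕ × ℕ × ℕ)) × List ℕ × List CodedConfig => x.1.2.1 :=
    Primrec.fst.comp (Primrec.snd.comp Primrec.fst)
  have hT : Primrec fun x : (ℕ × ℕ × List (ℕ × ℕ × ℕ)) × List ℕ × List CodedConfig => x.1.2.2 :=
    Primrec.snd.comp (Primrec.snd.comp Primrec.fst)
  have hmem : PrimrecPred fun x : List CodedConfig × CodedConfig => ∃ b ∈ x.1, b.Incl x.2 :=
    PrimrecPred.exists_mem_comp (p := fun (x : List CodedConfig × CodedConfig) b => b.Incl x.2)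
      Primrec.fst (primrecPred_incl.comp (Primrec.snd.pair (Primrec.snd.comp Primrec.fst)))
  refine (PrimrecPred.forall_mem_comp (primrec_initials.comp (hk.pair hs))
    (hmem.comp ((hB.comp Primrec.fst).pair Primrec.snd))).and
    (PrimrecPred.forall_mem_comp hB (PrimrecPred.and ?_ (PrimrecPred.and ?_ (PrimrecPred.and ?_
      (PrimrecPred.and ?_ ?_)))))
  · exact (Primrec.eq.comp (primrec_threads.comp Primrec.snd) (Primrec.const [])).not
  · exact PrimrecPred.mem_list (primrec_datum.comp Primrec.snd) (hV.comp Primrec.fst)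
  · exact PrimrecPred.forall_mem_comp (primrec_threads.comp Primrec.snd)
      (PrimrecPred.mem_list (Primrec.snd.comp Primrec.snd)
        (hV.comp (Primrec.fst.comp Primrec.fst)))
  · refine PrimrecPred.exists_mem_comp (hV.comp Primrec.fst) (PrimrecPred.and ?_ ?_)
    · exact (Primrec.eq.comp Primrec.snd
        (primrec_datum.comp (Primrec.snd.comp Primrec.fst))).not
    · exact PrimrecPred.forall_mem_comp (primrec_threads.comp (Primrec.snd.comp Primrec.fst))
        (Primrec.eq.comp (Primrec.snd.comp Primrec.snd) (Primrec.snd.comp Primrec.fst)).not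
  · exact PrimrecPred.forall_mem_comp (primrec_successors.comp ((hk.comp Primrec.fst).pair
      (((hT.comp Primrec.fst).pair (hV.comp Primrec.fst)).pair Primrec.snd)))
      (hmem.comp ((hB.comp (Primrec.fst.comp Primrec.fst)).pair Primrec.snd))

theorem primrec_reached :
    Primrec fun x : (ℕ × ℕ × List (ℕ × ℕ × ℕ)) × ℕ => reached x.1 x.2 := by
  have hstep : Primrec₂ fun (a : ℕ × ℕ × List (ℕ × ℕ × ℕ)) (x : ℕ × List CodedConfig) =>
      x.2 ++ x.2.flatMap (successors a.1 a.2.2 (List.range (x.1 + 2))) := by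
    have hk : Primrec fun x : ((ℕ × ℕ × List (ℕ × ℕ × ℕ)) × ℕ × List CodedConfig) × CodedConfig =>
      x.1.1.1 := Primrec.fst.comp (Primrec.fst.comp Primrec.fst)
    have hT : Primrec fun x : ((ℕ × ℕ × List (ℕ × ℕ × ℕ)) × ℕ × List CodedConfig) × CodedConfig =>
      x.1.1.2.2 := Primrec.snd.comp (Primrec.snd.comp (Primrec.fst.comp Primrec.fst))
    have hV : Primrec fun x : ((ℕ × ℕ × List (ℕ × ℕ × ℕ)) × ℕ × List CodedConfig) × CodedConfig =>
      List.range (x.1.2.1 + 2) := Primrec.list_range.comp (Primrec.nat_add.comp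
        (Primrec.fst.comp (Primrec.snd.comp Primrec.fst)) (Primrec.const 2))
    exact Primrec.list_append.comp (Primrec.snd.comp Primrec.snd)
      (Primrec.list_flatMap (Primrec.snd.comp Primrec.snd)
        (primrec_successors.comp (hk.pair ((hT.pair hV).pair Primrec.snd))).to₂)
  have h := Primrec.nat_rec (primrec_initials.comp
    (Primrec.fst.pair (Primrec.fst.comp Primrec.snd))) hstep
  refine Primrec.of_eq h fun x => ?_
  obtain ⟨a, m⟩ := x
  induction m with
  | zero => rfl
  | succ m ih => simp only at ih; simp only [reached, ih]

theorem data_of_mem_initials {s : ℕ} {c : CodedConfig} (hc : c ∈ initials k s) :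
    ∀ e ∈ c.data, e = 0 := by
  obtain ⟨-, -, hd, hΔ⟩ := mem_withLabels.1 hc
  rintro e (rfl | ⟨t, ht, rfl⟩)
  · simpa using hd
  · simp only [hΔ, List.mem_singleton] at ht
    simp [ht]

theorem exists_initial_codesPart (M : ARA A Q) (eA : A ≃ Fin k) (eQ : Q ≃ Fin n) (α : WordType)
    (γ : A × D) : ∃ c ∈ initials k (eQ M.start), ∃ g : ℕ → D,
      c.CodesPart eA eQ g ⟨0, α, γ, {(M.start, γ.2)}⟩ := by
  have hmem : (α.num, ↑(eA γ.1), 0, [(↑(eQ M.start), 0)]) ∈ initials k (eQ M.start) :=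
    mem_withLabels.2 ⟨α.num_eq, (eA γ.1).2, by simp, rfl⟩
  refine ⟨_, hmem, fun _ => γ.2, rfl, rfl, rfl, ?_, ?_⟩
  · intro s hs
    obtain rfl := List.mem_singleton.1 hs
    exact ⟨_, Finset.mem_singleton_self _, rfl, rfl⟩
  · exact fun e he e' he' _ =>
      (data_of_mem_initials hmem e he).trans (data_of_mem_initials hmem e' he').symm

variable [DecidableEq Q] [DecidableEq D]

theorem exists_codes_of_mem_initials {M : ARA A Q} {eA : A ≃ Fin k} {eQ : Q ≃ Fin n} {g : ℕ → D}
    (hg : Function.Injective g) {c : CodedConfig} (hc : c ∈ initials k (eQ M.start)) :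
    ∃ C, M.Reachable C ∧ c.Codes eA eQ g C := by
  obtain ⟨hα, ha, hd, hΔ⟩ := mem_withLabels.1 hc
  obtain ⟨α, hα⟩ := WordType.exists_num_eq hα
  have hd : c.datum = 0 := by simpa using hd
  refine ⟨_, ⟨α, (eA.symm ⟨c.letter, ha⟩, g 0), .refl⟩, ⟨hα, by simp, by rw [hd], ?_, hg.injOn⟩, ?_⟩
  · simp [hΔ, CodesThread]
  · simp [hΔ, CodesThread]

/-- Invariant along every path: some member of the certificate codes a part of the current
configuration. Members have threads, so the current configuration has some too. -/
theorem EmptinessCert.language_eq_empty {M : ARA A Q} {eA : A ≃ Fin k} {eQ : Q ≃ Fin n}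
    {x : List ℕ × List CodedConfig} (hx : EmptinessCert (M.code eA eQ) x) :
    M.language D = ∅ := by
  have key : ∀ C : Config A Q D, M.Reachable C → ∃ b ∈ x.2, ∃ g : ℕ → D,
      b.CodesPart eA eQ g C := by
    rintro C ⟨α, γ, h⟩
    induction h with
    | refl =>
      obtain ⟨c, hc, g, hg⟩ := exists_initial_codesPart M eA eQ α γ
      obtain ⟨b, hb, hbc⟩ := hx.1 c hc
      exact ⟨b, hb, g, hg.of_incl hbc⟩
    | tail _ hs ih =>
      obtain ⟨b, hb, g, hg⟩ := ih
      obtain ⟨-, hd, hΔ, ⟨v, hv, hvd, hvΔ⟩, hsucc⟩ := hx.2 b hb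
      obtain ⟨c, hc, g', hg'⟩ := hg.exists_successor hs (V := x.1)
        (by rintro e (rfl | ⟨t, ht, rfl⟩); exacts [hd, hΔ t ht])
        ⟨v, hv, by rintro (rfl | ⟨t, ht, rfl⟩); exacts [hvd rfl, hvΔ t ht rfl]⟩
      obtain rfl | hc := hc
      · exact ⟨c, hb, g', hg'⟩
      · obtain ⟨b', hb', hbc⟩ := hsucc c hc
        exact ⟨b', hb', g', hg'.of_incl hbc⟩
  rw [ARA.language_eq_empty_iff]
  intro C hC hacc
  obtain ⟨b, hb, g, hg⟩ := key C hC
  obtain ⟨s, hs⟩ := List.exists_mem_of_ne_nil _ (hx.2 b hb).1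
  obtain ⟨t, ht, -⟩ := hg.exists_thread s hs
  rw [Config.Accepting] at hacc
  simp [hacc] at ht

/-- A path is followed by codes of parts of its configurations. One new number per transition
suffices, so after `m` transitions the numbers up to `m` are enough. -/
theorem exists_mem_reached_of_language_ne_empty {M : ARA A Q} (eA : A ≃ Fin k) (eQ : Q ≃ Fin n)
    (h : M.language D ≠ ∅) : ∃ m, ∃ c ∈ reached (M.code eA eQ) m, c.threads = [] := by
  have key : ∀ C : Config A Q D, M.Reachable C → ∃ m, ∃ c ∈ reached (M.code eA eQ) m,
      (∀ e ∈ c.data, e ∈ List.range (m + 1)) ∧ ∃ g : ℕ → D, c.CodesPart eA eQ g C := by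
    rintro C ⟨α, γ, h⟩
    induction h with
    | refl =>
      obtain ⟨c, hc, g, hg⟩ := exists_initial_codesPart M eA eQ α γ
      exact ⟨0, c, hc, fun e he => by simp [data_of_mem_initials hc e he], g, hg⟩
    | tail _ hs ih =>
      obtain ⟨m, c, hc, hdata, g, hg⟩ := ih
      have hdata' : ∀ e ∈ c.data, e ∈ List.range (m + 2) := fun e he => by
        have := hdata e he
        simp only [List.mem_range] at this ⊢
        omega
      -- The number `m + 1` is the fresh one: the code reached so far uses only numbers up to `m`.
      obtain ⟨c', hc', g', hg'⟩ := hg.exists_successor hs hdata'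
        ⟨m + 1, by simp, fun h => by simpa using hdata _ h⟩
      obtain rfl | hc' := hc'
      · exact ⟨m + 1, c', List.mem_append_left _ hc, hdata', g', hg'⟩
      · exact ⟨m + 1, c', List.mem_append_right _ (List.mem_flatMap.2 ⟨c, hc, hc'⟩),
          data_subset_of_mem_successors hdata' hc', g', hg'⟩
  rw [Ne, ARA.language_eq_empty_iff] at h
  push Not at h
  obtain ⟨C, hC, hacc⟩ := h
  obtain ⟨m, c, hc, -, g, hg⟩ := key C hC
  refine ⟨m, c, hc, List.eq_nil_iff_forall_not_mem.2 fun s hs => ?_⟩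
  obtain ⟨t, ht, -⟩ := hg.exists_thread s hs
  rw [Config.Accepting] at hacc
  simp [hacc] at ht

theorem exists_codes_of_mem_reached {M : ARA A Q} {eA : A ≃ Fin k} {eQ : Q ≃ Fin n} {g : ℕ → D}
    (hg : Function.Injective g) {m : ℕ} : ∀ {c : CodedConfig}, c ∈ reached (M.code eA eQ) m →
      ∃ C, M.Reachable C ∧ c.Codes eA eQ g C := by
  induction m with
  | zero => exact fun hc => exists_codes_of_mem_initials hg hc
  | succ m ih =>
    intro c hc
    obtain hc | hc := List.mem_append.1 hc
    · exact ih hc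
    · obtain ⟨b, hb, hc⟩ := List.mem_flatMap.1 hc
      obtain ⟨C, hC, hbC⟩ := ih hb
      obtain ⟨C', hs, hcC'⟩ := hbC.exists_step hg hc
      exact ⟨C', hC.step hs, hcC'⟩

/-- Because `D` is infinite, all numbers decode injectively at once, and every explored code is then
the full code of a reachable configuration. -/
theorem language_ne_empty_of_mem_reached [Infinite D] {M : ARA A Q} {eA : A ≃ Fin k}
    {eQ : Q ≃ Fin n} {m : ℕ} {c : CodedConfig} (hc : c ∈ reached (M.code eA eQ) m)
    (hacc : c.threads = []) : M.language D ≠ ∅ := by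
  rw [Ne, ARA.language_eq_empty_iff]
  intro h
  obtain ⟨C, hC, hcC⟩ := exists_codes_of_mem_reached (Infinite.natEmbedding D).injective hc
  refine h C hC (Finset.eq_empty_of_forall_notMem fun t ht => ?_)
  obtain ⟨s, hs, -⟩ := hcC.exists_code t ht
  simp [hacc] at hs

end CodedConfig

/-- Otherwise, for each `K` there is a reachable `f K` including no reachable configuration with at
most `K` threads. By the well-quasi-order, a renaming of an early member of this sequence is
included in arbitrarily late ones. It is reachable, and its size is fixed, a contradiction. -/
theorem ARA.exists_card_threads_le [Finite A] [Finite Q] [DecidableEq Q] [DecidableEq D]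
    (M : ARA A Q) : ∃ K, ∀ C : Config A Q D, M.Reachable C →
      ∃ C₀, M.Reachable C₀ ∧ C₀.Incl C ∧ C₀.threads.card ≤ K := by
  by_contra! h
  choose f hf hK using h
  have : IsPreorder (Config A Q D) Config.Below :=
    { refl := Config.Below.refl, trans := fun _ _ _ => Config.Below.trans }
  obtain ⟨φ, hφ⟩ := Config.wellQuasiOrdered_below.exists_monotone_subseq f
  -- The later index is the number of threads of `f (φ 0)`; as `φ` is strictly increasing, `φ` of it
  -- is at least that number.
  obtain ⟨π, hπ⟩ := Config.below_iff.1 (hφ 0 (f (φ 0)).threads.card (Nat.zero_le _))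
  have h₁ := hK _ _ ((hf (φ 0)).rename π) hπ
  have h₂ : ((f (φ 0)).rename π).threads.card ≤ (f (φ 0)).threads.card := Finset.card_image_le
  have h₃ := φ.strictMono.id_le (f (φ 0)).threads.card
  simp only [id] at h₃
  omega

namespace CodedConfig

/-- The certificate consists of all codes, over `K + 2` numbers, of reachable configurations, with
at most `K` threads. A successor stays within these numbers but may have too many threads; it then
includes a small reachable code by the choice of `K`. -/
theorem exists_emptinessCert [DecidableEq Q] [DecidableEq D] [Infinite D] {M : ARA A Q}
    (eA : A ≃ Fin k) (eQ : Q ≃ Fin n) (h : M.language D = ∅) :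
    ∃ x, EmptinessCert (M.code eA eQ) x := by
  classical
  have : Finite A := .of_equiv _ eA.symm
  have : Finite Q := .of_equiv _ eQ.symm
  rw [ARA.language_eq_empty_iff] at h
  obtain ⟨K, hK⟩ := ARA.exists_card_threads_le (D := D) M
  obtain ⟨g, hg⟩ : ∃ g : ℕ → D, Function.Injective g := ⟨_, (Infinite.natEmbedding D).injective⟩
  -- Threads are collected in a `Finset` first, since lists with repetitions would give infinitely
  -- many codes.
  let toCode : ℕ × ℕ × ℕ × Finset (ℕ × ℕ) → CodedConfig := fun y =>
    (y.1, y.2.1, y.2.2.1, y.2.2.2.toList)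
  -- Of the `K + 2` numbers, at most `K` are register values and one is the current datum, so at
  -- least one is unused.
  let S : Set (ℕ × ℕ × ℕ × Finset (ℕ × ℕ)) := {y | y.2.2.2.card ≤ K ∧
    (∀ e ∈ (toCode y).data, e ∈ List.range (K + 2)) ∧
    ∃ C, M.Reachable C ∧ (toCode y).Codes eA eQ g C}
  have hS : S.Finite := by
    refine (Finset.finite_toSet (Finset.range 2 ×ˢ Finset.range k ×ˢ Finset.range (K + 2) ×ˢ
      (Finset.range n ×ˢ Finset.range (K + 2)).powerset)).subset ?_
    rintro y ⟨-, hdata, C, -, hC⟩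
    simp only [Finset.coe_product, Set.mem_prod, Finset.mem_coe, Finset.mem_range,
      Finset.mem_powerset]
    refine ⟨?_, ?_, List.mem_range.1 (hdata _ (datum_mem_data _)), fun s hs => ?_⟩
    · have : y.1 = C.type.num := hC.type_eq
      have := C.type.num_eq
      omega
    · have : y.2.1 = eA C.label.1 := hC.letter_eq
      omega
    · have hs' : s ∈ (toCode y).threads := Finset.mem_toList.2 hs
      obtain ⟨t, -, hst⟩ := hC.exists_thread s hs'
      have := hst.1
      have := List.mem_range.1 (hdata _ (mem_data_of_mem_threads hs'))
      simp only [Finset.mem_product, Finset.mem_range]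
      omega
  have hincl : ∀ {c : CodedConfig} {C : Config A Q D}, M.Reachable C → c.Codes eA eQ g C →
      (∀ e ∈ c.data, e ∈ List.range (K + 2)) → ∃ b ∈ hS.toFinset.toList.map toCode, b.Incl c := by
    intro c C hC hc hdata
    obtain ⟨C₀, hC₀, hinc, hcard⟩ := hK C hC
    -- The code of `C₀` is cut out of `c` itself, so no renaming is needed and plain inclusion
    -- suffices in the certificate.
    let Δ : Finset (ℕ × ℕ) := c.threads.toFinset.filter fun s =>
      ∃ t ∈ C₀.threads, CodesThread eQ g s t
    have hΔ : ∀ {s}, s ∈ Δ.toList ↔ s ∈ c.threads ∧ ∃ t ∈ C₀.threads, CodesThread eQ g s t := by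
      simp [Δ]
    have hb : (toCode (c.type, c.letter, c.datum, Δ)).Incl c :=
      ⟨rfl, rfl, rfl, fun s hs => (hΔ.1 hs).1⟩
    refine ⟨_, List.mem_map.2 ⟨_, Finset.mem_toList.2 (hS.mem_toFinset.2 ⟨?_, ?_, C₀, hC₀, ?_⟩),
      rfl⟩, hb⟩
    · have hex : ∀ s ∈ Δ, ∃ t ∈ C₀.threads, CodesThread eQ g s t := fun s hs =>
        (Finset.mem_filter.1 hs).2
      have : Nonempty (Q × D) := ⟨(M.start, g 0)⟩
      choose! f hf hsf using hex
      refine (Finset.card_le_card_of_injOn f hf fun s hs s' hs' hss' => ?_).trans hcard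
      have h' := hsf s' hs'
      rw [← hss'] at h'
      exact (hsf s hs).left_unique hg.injOn (Set.mem_univ _) (Set.mem_univ _) h'
    · rintro e (rfl | ⟨s, hs, rfl⟩)
      · exact hdata _ c.datum_mem_data
      · exact hdata _ (mem_data_of_mem_threads (hΔ.1 hs).1)
    · refine ⟨⟨hc.type_eq.trans (by rw [hinc.1]), hc.letter_eq.trans (by rw [hinc.2.1]),
        hc.datum_eq.trans (by rw [hinc.2.1]), fun s hs => (hΔ.1 hs).2, hg.injOn⟩, fun t ht => ?_⟩
      obtain ⟨s, hs, hst⟩ := hc.exists_code t (hinc.2.2 ht)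
      exact ⟨s, hΔ.2 ⟨hs, t, ht, hst⟩, hst⟩
  refine ⟨(List.range (K + 2), hS.toFinset.toList.map toCode), fun c hc => ?_, fun b hb => ?_⟩
  · obtain ⟨C, hC, hcC⟩ := exists_codes_of_mem_initials hg hc
    exact hincl hC hcC fun e he => by simp [data_of_mem_initials hc e he]
  · obtain ⟨y, hy, rfl⟩ := List.mem_map.1 hb
    obtain ⟨hcard, hdata, C, hC, hyC⟩ := hS.mem_toFinset.1 (Finset.mem_toList.1 hy)
    refine ⟨fun hnil => h C hC (Finset.eq_empty_of_forall_notMem fun t ht => ?_),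
      hdata _ (datum_mem_data _), fun t ht => hdata _ (mem_data_of_mem_threads ht), ?_,
      fun c hc => ?_⟩
    · obtain ⟨s, hs, -⟩ := hyC.exists_code t ht
      simp [hnil] at hs
    · have hlt : (insert y.2.2.1 (y.2.2.2.image Prod.snd)).card < (Finset.range (K + 2)).card := by
        have h₁ := Finset.card_insert_le y.2.2.1 (y.2.2.2.image Prod.snd)
        have h₂ := Finset.card_image_le (s := y.2.2.2) (f := Prod.snd)
        rw [Finset.card_range]
        omega
      obtain ⟨v, hv, hvn⟩ := Finset.exists_mem_notMem_of_card_lt_card hlt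
      rw [Finset.mem_insert, not_or] at hvn
      refine ⟨v, List.mem_range.2 (Finset.mem_range.1 hv), hvn.1, ?_⟩
      rintro t ht rfl
      exact hvn.2 (Finset.mem_image_of_mem _ (Finset.mem_toList.1 ht))
    · obtain ⟨C', hs, hcC'⟩ := hyC.exists_step hg hc
      exact hincl (hC.step hs) hcC' (data_subset_of_mem_successors hdata hc)

end CodedConfig

/-! ### Recognition of valid codes and the decision procedure. -/

/-- The triple `x` codes an instruction over `k` letters and `n` states. -/
def IsInstrCode (k n : ℕ) (x : ℕ × ℕ × ℕ) : Prop :=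
  ((x.1 = 0 ∨ x.1 = 1) ∧ x.2.1 < k ∧ x.2.2 = 0) ∨ (x.1 = 2 ∧ x.2.1 < 2 ∧ x.2.2 = 0) ∨
    ((x.1 = 3 ∨ x.1 = 8 ∨ x.1 = 9) ∧ x.2.1 < n ∧ x.2.2 = 0) ∨
    ((x.1 = 4 ∨ x.1 = 5) ∧ x.2.1 = 0 ∧ x.2.2 = 0) ∨
    ((x.1 = 6 ∨ x.1 = 7 ∨ x.1 = 10) ∧ x.2.1 < n ∧ x.2.2 < n)

theorem isInstrCode_code (eA : A ≃ Fin k) (eQ : Q ≃ Fin n) (φ : Instr A Q) :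
    IsInstrCode k n (φ.code eA eQ) := by
  rcases φ with _ | _ | ⟨_ | _⟩ | _ | _ | _ | _ | _ | _ | _ | _ <;> simp [IsInstrCode, Instr.code]

theorem IsInstrCode.exists_instr {x : ℕ × ℕ × ℕ} (h : IsInstrCode k n x) :
    ∃ φ : Instr (Fin k) (Fin n), φ.code (Equiv.refl _) (Equiv.refl _) = x := by
  obtain ⟨m, y, z⟩ := x
  obtain ⟨h | h, hy, hz⟩ | ⟨h, hy, hz⟩ | ⟨h | h | h, hy, hz⟩ | ⟨h | h, hy, hz⟩ |
    ⟨h | h | h, hy, hz⟩ := h <;> dsimp only at h hy hz <;> subst h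
  · subst hz; exact ⟨.letter ⟨y, hy⟩, rfl⟩
  · subst hz; exact ⟨.notLetter ⟨y, hy⟩, rfl⟩
  · subst hz
    obtain rfl | rfl : y = 0 ∨ y = 1 := by omega
    · exact ⟨.test .hasNext, rfl⟩
    · exact ⟨.test .isLast, rfl⟩
  · subst hz; exact ⟨.store ⟨y, hy⟩, rfl⟩
  · subst hz; exact ⟨.move ⟨y, hy⟩, rfl⟩
  · subst hz; exact ⟨.guess ⟨y, hy⟩, rfl⟩
  · subst hy hz; exact ⟨.eq, rfl⟩
  · subst hy hz; exact ⟨.neq, rfl⟩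
  · exact ⟨.and ⟨y, hy⟩ ⟨z, hz⟩, rfl⟩
  · exact ⟨.or ⟨y, hy⟩ ⟨z, hz⟩, rfl⟩
  · exact ⟨.spread ⟨y, hy⟩ ⟨z, hz⟩, rfl⟩

/-- The triple `a` codes an automaton. -/
def IsARACode (a : ℕ × ℕ × List (ℕ × ℕ × ℕ)) : Prop :=
  a.2.1 < a.2.2.length ∧ ∀ x ∈ a.2.2, IsInstrCode a.1 a.2.2.length x

theorem ARA.isARACode_code (M : ARA A Q) (eA : A ≃ Fin k) (eQ : Q ≃ Fin n) :
    IsARACode (M.code eA eQ) := by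
  refine ⟨by simp [ARA.code], fun x hx => ?_⟩
  obtain ⟨j, rfl⟩ := (List.mem_ofFn' _ _).1 hx
  simpa [ARA.code] using isInstrCode_code eA eQ (M.δ (eQ.symm j))

theorem IsARACode.exists_ara {a : ℕ × ℕ × List (ℕ × ℕ × ℕ)} (h : IsARACode a) :
    ∃ M : ARA (Fin a.1) (Fin a.2.2.length), M.code (Equiv.refl _) (Equiv.refl _) = a := by
  have hφ : ∀ j : Fin a.2.2.length, ∃ φ : Instr (Fin a.1) (Fin a.2.2.length),
      φ.code (Equiv.refl _) (Equiv.refl _) = a.2.2[j] := fun j =>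
    (h.2 _ (List.getElem_mem _)).exists_instr
  choose δ hδ using hφ
  refine ⟨⟨⟨a.2.1, h.1⟩, δ⟩, ?_⟩
  simp [ARA.code, hδ]

theorem primrecPred_isARACode : PrimrecPred IsARACode := by
  have hlen : Primrec fun a : ℕ × ℕ × List (ℕ × ℕ × ℕ) => a.2.2.length :=
    Primrec.list_length.comp (Primrec.snd.comp Primrec.snd)
  have hk : Primrec fun x : (ℕ × ℕ × List (ℕ × ℕ × ℕ)) × ℕ × ℕ × ℕ => x.1.1 :=
    Primrec.fst.comp Primrec.fst
  have hn : Primrec fun x : (ℕ × ℕ × List (ℕ × ℕ × ℕ)) × ℕ × ℕ × ℕ => x.1.2.2.length :=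
    hlen.comp Primrec.fst
  have hm : Primrec fun x : (ℕ × ℕ × List (ℕ × ℕ × ℕ)) × ℕ × ℕ × ℕ => x.2.1 :=
    Primrec.fst.comp Primrec.snd
  have hy : Primrec fun x : (ℕ × ℕ × List (ℕ × ℕ × ℕ)) × ℕ × ℕ × ℕ => x.2.2.1 :=
    Primrec.fst.comp (Primrec.snd.comp Primrec.snd)
  have hz : Primrec fun x : (ℕ × ℕ × List (ℕ × ℕ × ℕ)) × ℕ × ℕ × ℕ => x.2.2.2 :=
    Primrec.snd.comp (Primrec.snd.comp Primrec.snd)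
  have tag (i : ℕ) := Primrec.eq.comp hm (Primrec.const i)
  have hz₀ := Primrec.eq.comp hz (Primrec.const 0)
  refine (Primrec.nat_lt.comp (Primrec.fst.comp Primrec.snd) hlen).and
    (PrimrecPred.forall_mem_comp (Primrec.snd.comp Primrec.snd) ?_)
  exact (((tag 0).or (tag 1)).and ((Primrec.nat_lt.comp hy hk).and hz₀)).or <|
    ((tag 2).and ((Primrec.nat_lt.comp hy (Primrec.const 2)).and hz₀)).or <|
    (((tag 3).or ((tag 8).or (tag 9))).and ((Primrec.nat_lt.comp hy hn).and hz₀)).or <|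
    (((tag 4).or (tag 5)).and ((Primrec.eq.comp hy (Primrec.const 0)).and hz₀)).or <|
    ((tag 6).or ((tag 7).or (tag 10))).and ((Primrec.nat_lt.comp hy hn).and
      (Primrec.nat_lt.comp hz hn))

/-- The search that decides emptiness: `m` is large enough to reach an accepting configuration, or
codes a certificate of emptiness. Triples that do not code an automaton are accepted at once. -/
def DecidesEmptiness (a : ℕ × ℕ × List (ℕ × ℕ × ℕ)) (m : ℕ) : Prop :=
  ¬ IsARACode a ∨ CodedConfig.EmptinessCert a (Denumerable.ofNat _ m) ∨
    ∃ c ∈ CodedConfig.reached a m, c.threads = []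

theorem primrecPred_emptinessCert_ofNat :
    PrimrecPred fun x : (ℕ × ℕ × List (ℕ × ℕ × ℕ)) × ℕ =>
      CodedConfig.EmptinessCert x.1 (Denumerable.ofNat _ x.2) :=
  CodedConfig.primrecPred_emptinessCert.comp
    (Primrec.fst.pair ((Primrec.ofNat (List ℕ × List CodedConfig)).comp Primrec.snd))

theorem primrecPred_decidesEmptiness :
    PrimrecPred fun x : (ℕ × ℕ × List (ℕ × ℕ × ℕ)) × ℕ => DecidesEmptiness x.1 x.2 :=
  (primrecPred_isARACode.comp Primrec.fst).not.or <| primrecPred_emptinessCert_ofNat.or <|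
    PrimrecPred.exists_mem_comp
      (p := fun (_ : (ℕ × ℕ × List (ℕ × ℕ × ℕ)) × ℕ) (c : CodedConfig) => c.threads = [])
      CodedConfig.primrec_reached
      (Primrec.eq.comp (CodedConfig.primrec_threads.comp Primrec.snd) (Primrec.const []))

/-- Termination of the search. An invalid code stops it at once; for a valid one, either the
language is empty and a certificate exists, or an accepting code is eventually reached. -/
theorem exists_decidesEmptiness (D : Type u) [DecidableEq D] [Infinite D]
    (a : ℕ × ℕ × List (ℕ × ℕ × ℕ)) : ∃ m, DecidesEmptiness a m := by
  by_cases ha : IsARACode a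
  · obtain ⟨M, hM⟩ := ha.exists_ara
    by_cases h : M.language D = ∅
    · obtain ⟨x, hx⟩ := CodedConfig.exists_emptinessCert (Equiv.refl _) (Equiv.refl _) h
      rw [hM] at hx
      exact ⟨Encodable.encode x, .inr (.inl (by rwa [Denumerable.ofNat_encode]))⟩
    · obtain ⟨m, hm⟩ := CodedConfig.exists_mem_reached_of_language_ne_empty
        (Equiv.refl _) (Equiv.refl _) h
      rw [hM] at hm
      exact ⟨m, .inr (.inr hm)⟩
  · exact ⟨0, .inl ha⟩

/-- Unbounded search for the least witness of `R` is total by `h`; the computable test `E` is then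
applied to the witness found. -/
theorem ComputablePred.exists_search {α : Type*} [Primcodable α] {R E : α → ℕ → Prop}
    (hR : ComputablePred fun x : α × ℕ => R x.1 x.2)
    (hE : ComputablePred fun x : α × ℕ => E x.1 x.2) (h : ∀ a, ∃ m, R a m) :
    ∃ f : α → ℕ, ComputablePred (fun a => E a (f a)) ∧ ∀ a, R a (f a) := by
  classical
  exact ⟨_, Computable.computablePred (hE.decide.comp (Computable.id.pair (Computable.find hR h))),
    fun a => Nat.find_spec (h a)⟩

/-- The answer is whether the least `m` found by the search codes a certificate. If it does, the
language is empty by soundness. If the language is empty, the other two ways to stop are excluded,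
since the code is valid and no accepting code can be reached. -/
theorem exists_computablePred_emptiness (D : Type u) [DecidableEq D] [Infinite D] :
    ∃ P : ℕ × ℕ × List (ℕ × ℕ × ℕ) → Prop, ComputablePred P ∧
      ∀ (A : Type v) (Q : Type w) [DecidableEq Q] (k n : ℕ) (eA : A ≃ Fin k) (eQ : Q ≃ Fin n)
        (M : ARA A Q), P (M.code eA eQ) ↔ M.language D = ∅ := by
  obtain ⟨f, hf, hfind⟩ := ComputablePred.exists_search
    (E := fun a m => CodedConfig.EmptinessCert a (Denumerable.ofNat _ m))
    primrecPred_decidesEmptiness.computablePred primrecPred_emptinessCert_ofNat.computablePred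
    (exists_decidesEmptiness D)
  refine ⟨_, hf, fun A Q _ k n eA eQ M => ⟨fun h => h.language_eq_empty, fun h => ?_⟩⟩
  obtain h' | h' | ⟨c, hc, hacc⟩ := hfind (M.code eA eQ)
  · exact absurd (M.isARACode_code eA eQ) h'
  · exact h'
  · exact absurd h (CodedConfig.language_ne_empty_of_mem_reached hc hacc)

theorem mainTheorem3 (D : Type u) [DecidableEq D] [Infinite D] :
    (∃ P : ℕ × ℕ × List (ℕ × ℕ × ℕ) → Prop, ComputablePred P ∧
      ∀ (A : Type v) (Q : Type w) [DecidableEq Q] (k n : ℕ) (eA : A ≃ Fin k) (eQ : Q ≃ Fin n)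
        (M : ARA A Q), P (M.code eA eQ) ↔ M.language D = ∅) ∧
    ∀ (A : Type v) (Q : Type w) [Finite A] [Finite Q] [DecidableEq Q] (M : ARA A Q),
      IsWQO (Config.Below (A := A) (Q := Q) (D := D)) ∧
      IsRDC (M.Step (D := D)) Config.Below ∧
      IsDownwardClosed Config.Below {C : Config A Q D | C.Accepting} :=
  ⟨exists_computablePred_emptiness D, fun _ _ _ _ _ M =>
    ⟨Config.isWQO_below, M.isRDC_step, fun _ _ hb hab => hab.accepting hb⟩⟩
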